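/- **Setting.** Let $d\ge 1$, $L>0$, let $N\ge 2$ be an even integer, $\mathbf j_*\in\mathbb Z^d\setminus\{\mathbf 0\}$ and $\phi_{\mathbf j_*}=\phi_{-\mathbf j_*}>0$. For $\mathbf j\in\mathbb Z^d$ put $k_{\mathbf j}=\frac{2\pi}{L}\mathbf j$, and put $\Delta_0=\min\{k_{\mathbf j}^2:\mathbf j\ne\mathbf 0\}$, $\epsilon=k_{\mathbf j_*}^2/\phi_{\mathbf j_*}$, $$E^{Bog}_{\mathbf j_*}=-\Big[k^2_{\mathbf j_*}+\phi_{\mathbf j_*}-\sqrt{(k^2_{\mathbf j_*})^2+2\phi_{\mathbf j_*}k^2_{\mathbf j_*}}\Big],\qquad z_{\max}=E^{Bog}_{\mathbf j_*}+\sqrt{\epsilon}\,\phi_{\mathbf j_*}\sqrt{\epsilon^2+2\epsilon}.$$ On the $N$-particle sector $\mathcal F^N$ of the bosonic Fock space over $L^2$ of the torus of side $L$, with $a_{\mathbf j},a^*_{\mathbf j}$ the annihilation and creation operators of the mode $k_{\mathbf j}$, let $W=\phi_{\mathbf j_*}\frac{a_{\mathbf 0}^*a_{\mathbf 0}^*a_{\mathbf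 j_*}a_{-\mathbf j_*}}{N}$, let $W^*=\phi_{\mathbf j_*}\frac{a_{\mathbf 0}a_{\mathbf 0}a^*_{\mathbf j_*}a^*_{-\mathbf j_*}}{N}$ and $$H=\sum_{\mathbf j\ne\pm\mathbf j_*}k_{\mathbf j}^2a^*_{\mathbf j}a_{\mathbf j}+\sum_{\mathbf j=\pm\mathbf j_*}\Big(k_{\mathbf j}^2+\phi_{\mathbf j_*}\frac{a_{\mathbf 0}^*a_{\mathbf 0}}{N}\Big)a^*_{\mathbf j}a_{\mathbf j}+W+W^* .$$ For even $i$, $0\le i\le N-2$, let $Q^{(i,i+1)}$ and $Q^{(>i+1)}$ be the orthogonal projections of $\mathcal F^N$ onto the vectors with, respectively, $N-i$ or $N-i-1$, and fewer than $N-i-1$, particles in the modes $\pm\mathbf j_*$. Let $\eta$ be the normalized state with all $N$ particles in the mode $\mathbf 0$, $\mathscr P_\eta=|\eta\rangle\langle\eta|$ and $\overline{\mathscr P_\eta}=Q^{(>N-1)}-\mathscr P_\eta$. For projections $P,\overline P$ and an operator $K$ the Feshbach–Schur map is $\mathscr F_{P,\overline P}(K)=PKP-PK\overline P\,(\overline PK\overline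 P)^{-1}\overline PKP$, the inverse being taken on the range of $\overline P$. For real $z$ put $\mathscr K^{(-2)}(z)=H-z$, $\mathscr K^{(i)}(z)=\mathscr F_{Q^{(>i+1)},\,Q^{(i,i+1)}}(\mathscr K^{(i-2)}(z))$ for $i=0,2,\dots,N-2$, and $\mathscr K^{(N)}(z)=\mathscr F_{\mathscr P_\eta,\overline{\mathscr P_\eta}}(\mathscr K^{(N-2)}(z))$. Let $$R_i(z)=Q^{(i,i+1)}\big(Q^{(i,i+1)}(H-z)Q^{(i,i+1)}\big)^{-1}Q^{(i,i+1)},\qquad \Gamma_0(z)=0,$$ $$\Gamma_{i}(z)=Q^{(i,i+1)}W\,R_{i-2}(z)\sum_{l\ge 0}\big[\Gamma_{i-2}(z)R_{i-2}(z)\big]^{l}\,W^*Q^{(i,i+1)}\quad (i=2,4,\dots,N-2),$$ $$f(z)=-z-\Big\langle\eta,\;W\,R_{N-2}(z)\sum_{l\ge0}\big[\Gamma_{N-2}(z)R_{N-2}(z)\big]^{l}\,W^*\eta\Big\rangle .$$ **Lemma.** For every $0<\gamma<1$ there is $k_\gamma>0$ such that for all $0<\mu<1$, $\theta>0$ and $C>0$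 there is $\epsilon_0>0$ (depending only on $\gamma,\mu,\theta,C$) for which the following holds for all $d,L,N,\mathbf j_*,\phi_{\mathbf j_*}$ as above with $\epsilon\le\epsilon_0$. Assume $$\epsilon^2+\frac{\epsilon}{N^\gamma}+\frac1N\le k_\gamma\,\epsilon\sqrt\epsilon,\qquad \frac1{N^{1-\gamma}}\le k_\gamma\,\epsilon,$$ $$\frac{\phi_{\mathbf j_*}}{\Delta_0}\,\frac{N^\mu}{N(N-N^\mu)}<\frac12,\qquad \frac1{N^\mu}\le C\,(\sqrt\epsilon)^{1+\theta}.$$ Then: 1. For every $z\le z_{\max}$ all inverses occurring in $\mathscr K^{(i)}(z)$, $i=0,2,\dots,N-2$, exist as bounded operators, and so do the resolvents $R_i(z)$; the Neumann series $\sum_l[\Gamma_i(z)R_i(z)]^l$, $i=0,2,\dots,N-2$, are summable in operator norm. In particular $\mathscr K^{(N-2)}(z)$ and $f(z)$ are well defined. 2. There is exactly one $z_*\le z_{\max}$ with $f(z_*)=0$, and it satisfies $z_*<\min\{z_*+\frac{\Delta_0}2,\;z_{\max}\}$. 3. For every $z<\min\{z_*+\frac{\Delta_0}2,\;z_{\max}\}$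 the operator $\overline{\mathscr P_\eta}\,\mathscr K^{(N-2)}(z)\,\overline{\mathscr P_\eta}$ is bounded invertible on $\overline{\mathscr P_\eta}\mathcal F^N$; hence $\mathscr K^{(N)}(z)$ is well defined, and $\mathscr K^{(N)}(z)=f(z)\,|\eta\rangle\langle\eta|$. -/

import Mathlib

open scoped InnerProductSpace

noncomputable section

namespace BogThreeModes

/-! ### Modes, occupation numbers, the `N`-particle space -/

/-- Labels `j ∈ ℤ^d` of the momentum modes `(2π/L) j`. -/
abbrev Mode (d : ℕ) := Fin d → ℤ

/-- Occupation numbers: finitely many particles distributed over the modes. -/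
abbrev Occ (d : ℕ) := Mode d →₀ ℕ

/-- Occupation numbers of exactly `N` particles. -/
abbrev Config (d N : ℕ) := {n : Occ d // (n.sum fun _ m => m) = N}

/-- The `N`-particle sector of the bosonic Fock space over `L²` of the torus, in the occupation
number representation: `ψ c` is the coefficient of `ψ` along the normalized product state with
occupation numbers `c`. -/
abbrev FockN (d N : ℕ) := lp (fun _ : Config d N => ℂ) 2

/-- Linear operators on arbitrary (not necessarily square summable) coefficient families. -/
abbrev FormalOp (d : ℕ) := Module.End ℂ (Occ d → ℂ)

/-- The annihilation operator `a_j`. -/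
def annih {d : ℕ} (j : Mode d) : FormalOp d where
  toFun ψ n := (Real.sqrt (n j + 1) : ℂ) * ψ (n + Finsupp.single j 1)
  map_add' ψ χ := by ext n; simp [mul_add]
  map_smul' r ψ := by ext n; simp [mul_left_comm]

/-- The creation operator `a_j^*`. If `n j = 0` the prefactor vanishes. -/
def creat {d : ℕ} (j : Mode d) : FormalOp d where
  toFun ψ n := (Real.sqrt (n j) : ℂ) * ψ (n - Finsupp.single j 1)
  map_add' ψ χ := by ext n; simp [mul_add]
  map_smul' r ψ := by ext n; simp [mul_left_comm]

/-- `k_j² = |(2π/L) j|²`. -/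
def kSq {d : ℕ} (L : ℝ) (j : Mode d) : ℝ := ∑ i, (2 * Real.pi / L * (j i : ℝ)) ^ 2

/-- `Δ₀ = min {k_j² : j ≠ 0}`. -/
def gap (d : ℕ) (L : ℝ) : ℝ := ⨅ j : {j : Mode d // j ≠ 0}, kSq L j.1

/-- `∑_{j ≠ ± j⋆} k_j² a_j^* a_j`. On the coefficient at `n` only the modes occupied in `n`
contribute. -/
def kineticRest {d : ℕ} (L : ℝ) (js : Mode d) : FormalOp d where
  toFun ψ n := ∑ j ∈ n.support with j ≠ js ∧ j ≠ -js, (kSq L j : ℂ) * (creat j * annih j) ψ n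
  map_add' ψ χ := by ext n; simp [mul_add, Finset.sum_add_distrib]
  map_smul' r ψ := by ext n; simp [Finset.mul_sum, mul_left_comm]

/-- `Ĥ⁰_j = (k_j² + φ a₀^* a₀ / N) a_j^* a_j + (k_j² + φ a₀^* a₀ / N) a_{-j}^* a_{-j}`. -/
def hZero {d : ℕ} (N : ℕ) (L φ : ℝ) (j : Mode d) : FormalOp d :=
  ((kSq L j : ℂ) • (1 : FormalOp d) + ((φ / N : ℝ) : ℂ) • (creat 0 * annih 0))
      * (creat j * annih j)
    + ((kSq L j : ℂ) • (1 : FormalOp d) + ((φ / N : ℝ) : ℂ) • (creat 0 * annih 0))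
      * (creat (-j) * annih (-j))

/-- `W_j = φ a₀^* a₀^* a_j a_{-j} / N`. -/
def wFormal {d : ℕ} (N : ℕ) (φ : ℝ) (j : Mode d) : FormalOp d :=
  ((φ / N : ℝ) : ℂ) • (creat 0 * creat 0 * annih j * annih (-j))

/-- `W_j^* = φ a₀ a₀ a_j^* a_{-j}^* / N`. -/
def wStarFormal {d : ℕ} (N : ℕ) (φ : ℝ) (j : Mode d) : FormalOp d :=
  ((φ / N : ℝ) : ℂ) • (annih 0 * annih 0 * creat j * creat (-j))

/-- The three-modes Bogoliubov Hamiltonian as a formal operator. -/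
def hBogFormal {d : ℕ} (N : ℕ) (L φ : ℝ) (js : Mode d) : FormalOp d :=
  kineticRest L js + (hZero N L φ js + wFormal N φ js + wStarFormal N φ js)

/-- Number of particles in the modes `± j⋆`. -/
def pairNum {d : ℕ} (js : Mode d) (n : Occ d) : ℕ := n js + n (-js)

/-- Restriction of coefficients to the occupation numbers in `S`. -/
def cutFormal {d : ℕ} (S : Set (Occ d)) : FormalOp d where
  toFun ψ n := S.indicator 1 n * ψ n
  map_add' ψ χ := by ext n; simp [mul_add]
  map_smul' r ψ := by ext n; simp [mul_left_comm]

/-! ### Realization of formal operators on the `N`-particle space -/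

/-- An `N`-particle coefficient family as a family on all occupation numbers. -/
def extend {d N : ℕ} : (Config d N → ℂ) →ₗ[ℂ] (Occ d → ℂ) where
  toFun ψ n := if h : (n.sum fun _ m => m) = N then ψ ⟨n, h⟩ else 0
  map_add' ψ χ := by ext n; by_cases h : (n.sum fun _ m => m) = N <;> simp [h]
  map_smul' r ψ := by ext n; by_cases h : (n.sum fun _ m => m) = N <;> simp [h]

/-- The action of a (number preserving) formal operator on `N`-particle coefficients. -/
def act {d N : ℕ} (A : FormalOp d) (ψ : FockN d N) (c : Config d N) : ℂ :=
  A (extend (fun c' => ψ c')) c.1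

/-- The operator on the `N`-particle space given by `A`, on its maximal domain
`{ψ : A ψ is square summable}`. -/
def realize {d : ℕ} (N : ℕ) (A : FormalOp d) : FockN d N →ₗ.[ℂ] FockN d N where
  domain :=
    { carrier := {ψ | Memℓp (act A ψ) 2}
      add_mem' := by
        intro ψ χ hψ hχ
        have h : act A (ψ + χ) = act A ψ + act A χ := by
          ext c
          simp only [act, Pi.add_apply]
          rw [← Pi.add_apply (A _), ← map_add, ← map_add]
          rfl
        show Memℓp _ 2
        rw [h]
        exact Memℓp.add hψ hχ
      zero_mem' := by
        have h : act A (0 : FockN d N) = 0 := by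
          ext c
          have : (fun c' => (0 : FockN d N) c') = (0 : Config d N → ℂ) := rfl
          simp only [act]
          rw [this, map_zero, map_zero]
          rfl
        show Memℓp _ 2
        rw [h]
        exact zero_memℓp
      smul_mem' := by
        intro r ψ hψ
        have h : act A (r • ψ) = r • act A ψ := by
          ext c
          simp only [act, Pi.smul_apply]
          rw [← Pi.smul_apply r (A _), ← map_smul, ← map_smul]
          rfl
        show Memℓp _ 2
        rw [h]
        exact Memℓp.const_smul hψ r }
  toFun :=
    { toFun := fun ψ => ⟨act A ψ.1, ψ.2⟩
      map_add' := by
        intro ψ χ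
        ext c
        simp only [act, lp.coeFn_add, Pi.add_apply, Submodule.coe_add]
        rw [← Pi.add_apply (A _), ← map_add, ← map_add]
        rfl
      map_smul' := by
        intro r ψ
        ext c
        simp only [act, lp.coeFn_smul, Pi.smul_apply, Submodule.coe_smul, RingHom.id_apply]
        rw [← Pi.smul_apply r (A _), ← map_smul, ← map_smul]
        rfl }

/-- The bounded operator on the `N`-particle space given by `A` (it exists for all the formal
operators it is applied to, see `boundedOp_cut`, `boundedOp_w` and `boundedOp_wStar`). -/
def boundedOp {d : ℕ} (N : ℕ) (A : FormalOp d) : FockN d N →L[ℂ] FockN d N := by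
  classical
  exact if h : ∃ B : FockN d N →L[ℂ] FockN d N, ∀ ψ c, B ψ c = act A ψ c then h.choose else 0

theorem sum_extend_le {d N : ℕ} (ψ : FockN d N) (T : Finset (Occ d)) :
    ∑ n ∈ T, ‖extend (fun c' => ψ c') n‖ ^ 2 ≤ ‖ψ‖ ^ 2 := by
  classical
  have h1 : ∑ n ∈ T, ‖extend (fun c' => ψ c') n‖ ^ 2
      = ∑ n ∈ T with (n.sum fun _ m => m) = N, ‖extend (fun c' => ψ c') n‖ ^ 2 := by
    rw [Finset.sum_filter]
    refine Finset.sum_congr rfl fun n _ => ?_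
    split_ifs with h
    · rfl
    · simp [extend, h]
  rw [h1, ← Finset.sum_subtype_eq_sum_filter]
  have h2 := lp.sum_rpow_le_norm_rpow (p := 2) (by simp) ψ
    (T.subtype fun n => (n.sum fun _ m => m) = N)
  simp only [ENNReal.toReal_ofNat, Real.rpow_ofNat] at h2
  refine le_trans (le_of_eq ?_) h2
  refine Finset.sum_congr rfl fun c _ => ?_
  simp [extend, c.2]

theorem exists_bounded {d N : ℕ} (A : FormalOp d) (w : Occ d → ℂ) (σ : Occ d → Occ d) (C : ℝ)
    (hA : ∀ ψ n, A ψ n = w n * ψ (σ n)) (hC : ∀ c : Config d N, ‖w c.1‖ ≤ C)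
    (hσ : Set.InjOn σ {n | w n ≠ 0}) :
    ∃ B : FockN d N →L[ℂ] FockN d N, ∀ ψ c, B ψ c = act A ψ c := by
  classical
  have key : ∀ (ψ : FockN d N) (s : Finset (Config d N)),
      ∑ c ∈ s, ‖act A ψ c‖ ^ 2 ≤ C ^ 2 * ‖ψ‖ ^ 2 := by
    intro ψ s
    have hinj : Set.InjOn (fun c : Config d N => σ c.1) (s.filter fun c => w c.1 ≠ 0) := by
      intro a ha b hb hab
      simp only [Finset.coe_filter, Set.mem_ofPred_eq] at ha hb
      exact Subtype.ext (hσ ha.2 hb.2 hab)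
    calc ∑ c ∈ s, ‖act A ψ c‖ ^ 2
        = ∑ c ∈ s with w c.1 ≠ 0, ‖act A ψ c‖ ^ 2 := by
          rw [Finset.sum_filter]
          refine Finset.sum_congr rfl fun c _ => ?_
          split_ifs with h
          · rfl
          · have h0 : w c.1 = 0 := not_not.mp h
            simp [act, hA, h0]
      _ ≤ ∑ c ∈ s with w c.1 ≠ 0, C ^ 2 * ‖extend (fun c' => ψ c') (σ c.1)‖ ^ 2 := by
          refine Finset.sum_le_sum fun c _ => ?_
          simp only [act, hA, norm_mul, mul_pow]
          gcongr
          exact hC c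
      _ = C ^ 2 * ∑ n ∈ (s.filter fun c => w c.1 ≠ 0).image (fun c => σ c.1),
            ‖extend (fun c' => ψ c') n‖ ^ 2 := by
          rw [Finset.sum_image hinj, Finset.mul_sum]
      _ ≤ C ^ 2 * ‖ψ‖ ^ 2 := by
          gcongr
          exact sum_extend_le ψ _
  have hmem : ∀ ψ : FockN d N, Memℓp (act A ψ) 2 := fun ψ =>
    memℓp_gen' (C := C ^ 2 * ‖ψ‖ ^ 2) fun s => by simpa using key ψ s
  let T : FockN d N →ₗ[ℂ] FockN d N :=
    { toFun := fun ψ => (realize N A).toFun ⟨ψ, hmem ψ⟩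
      map_add' := fun ψ χ => (realize N A).toFun.map_add ⟨ψ, hmem ψ⟩ ⟨χ, hmem χ⟩
      map_smul' := fun r ψ => (realize N A).toFun.map_smul r ⟨ψ, hmem ψ⟩ }
  refine ⟨T.mkContinuous |C| fun ψ => ?_, fun ψ c => rfl⟩
  refine lp.norm_le_of_forall_sum_le (by simp) (by positivity) fun s => ?_
  have h := key ψ s
  rw [← sq_abs C, ← mul_pow] at h
  simp only [ENNReal.toReal_ofNat, Real.rpow_ofNat]
  exact h

theorem boundedOp_spec {d N : ℕ} {A : FormalOp d}
    (h : ∃ B : FockN d N →L[ℂ] FockN d N, ∀ ψ c, B ψ c = act A ψ c) (ψ : FockN d N)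
    (c : Config d N) : boundedOp N A ψ c = act A ψ c := by
  unfold boundedOp
  rw [dif_pos h]
  exact h.choose_spec ψ c

theorem boundedOp_cut {d N : ℕ} (S : Set (Occ d)) (ψ : FockN d N) (c : Config d N) :
    boundedOp N (cutFormal S) ψ c = act (cutFormal S) ψ c := by
  refine boundedOp_spec (exists_bounded _ (S.indicator 1) id 1 (fun _ _ => rfl) ?_ ?_) ψ c
  · intro c
    by_cases h : c.1 ∈ S <;> simp [h]
  · exact Function.injective_id.injOn

theorem le_of_config {d N : ℕ} (c : Config d N) (j : Mode d) : c.1 j ≤ N := by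
  have h := c.2
  by_cases hj : j ∈ c.1.support
  · calc c.1 j ≤ ∑ i ∈ c.1.support, c.1 i :=
        Finset.single_le_sum (f := fun i => c.1 i) (fun _ _ => Nat.zero_le _) hj
      _ = N := h
  · simp [Finsupp.notMem_support_iff.mp hj]

theorem boundedOp_w {d N : ℕ} (φ : ℝ) (j : Mode d) (ψ : FockN d N) (c : Config d N) :
    boundedOp N (wFormal N φ j) ψ c = act (wFormal N φ j) ψ c := by
  have hle : ∀ (c : Config d N) (k : Mode d) (n : Occ d), n ≤ c.1 → n k ≤ N := fun c k n h =>
    (h k).trans (le_of_config c k)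
  let e : Mode d → Occ d := fun k => Finsupp.single k 1
  refine boundedOp_spec (exists_bounded _
    (fun n => ((φ / N : ℝ) : ℂ) * ((Real.sqrt (n 0) : ℂ) * ((Real.sqrt ((n - e 0) 0) : ℂ) *
      ((Real.sqrt ((n - e 0 - e 0) j + 1) : ℂ) *
        (Real.sqrt ((n - e 0 - e 0 + e j) (-j) + 1) : ℂ)))))
    (fun n => n - e 0 - e 0 + e j + e (-j))
    (|φ / N| * (Real.sqrt (N + 2) * (Real.sqrt (N + 2) * (Real.sqrt (N + 2) *
      Real.sqrt (N + 2))))) ?_ ?_ ?_) ψ c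
  · intro ψ n
    simp only [wFormal, creat, annih, LinearMap.smul_apply, Module.End.mul_apply,
      LinearMap.coe_mk, AddHom.coe_mk, Pi.smul_apply, smul_eq_mul, e]
    ring
  · intro c
    have h0 : c.1 0 ≤ N := le_of_config c 0
    have h1 : (c.1 - e 0) 0 ≤ N := hle c _ _ tsub_le_self
    have h2 : (c.1 - e 0 - e 0) j ≤ N := hle c _ _ (tsub_le_self.trans tsub_le_self)
    have h3 : (c.1 - e 0 - e 0) (-j) ≤ N := hle c _ _ (tsub_le_self.trans tsub_le_self)
    have h4 : (c.1 - e 0 - e 0 + e j) (-j) ≤ N + 1 := by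
      have : e j (-j) ≤ 1 := by
        simp only [e, Finsupp.single_apply]; split_ifs <;> simp
      rw [Finsupp.add_apply]; omega
    have h0' : ((c.1 0 : ℕ) : ℝ) ≤ N := by exact_mod_cast h0
    have h1' : (((c.1 - e 0) 0 : ℕ) : ℝ) ≤ N := by exact_mod_cast h1
    have h2' : (((c.1 - e 0 - e 0) j : ℕ) : ℝ) ≤ N := by exact_mod_cast h2
    have h4' : (((c.1 - e 0 - e 0 + e j) (-j) : ℕ) : ℝ) ≤ N + 1 := by exact_mod_cast h4
    simp only [norm_mul, Complex.norm_real, Real.norm_eq_abs, abs_of_nonneg (Real.sqrt_nonneg _)]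
    have g0 := Real.sqrt_le_sqrt (show ((c.1 0 : ℕ) : ℝ) ≤ N + 2 by linarith)
    have g1 := Real.sqrt_le_sqrt (show (((c.1 - e 0) 0 : ℕ) : ℝ) ≤ N + 2 by linarith)
    have g2 := Real.sqrt_le_sqrt (show (((c.1 - e 0 - e 0) j : ℕ) : ℝ) + 1 ≤ N + 2 by linarith)
    have g4 := Real.sqrt_le_sqrt
      (show (((c.1 - e 0 - e 0 + e j) (-j) : ℕ) : ℝ) + 1 ≤ N + 2 by linarith)
    exact mul_le_mul_of_nonneg_left (mul_le_mul g0 (mul_le_mul g1 (mul_le_mul g2 g4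
      (by positivity) (by positivity)) (by positivity) (by positivity)) (by positivity)
      (by positivity)) (abs_nonneg _)
  · intro a ha b hb hab
    have two : ∀ n : Occ d, (((φ / N : ℝ) : ℂ) * ((Real.sqrt (n 0) : ℂ) *
        ((Real.sqrt ((n - e 0) 0) : ℂ) * ((Real.sqrt ((n - e 0 - e 0) j + 1) : ℂ) *
        (Real.sqrt ((n - e 0 - e 0 + e j) (-j) + 1) : ℂ))))) ≠ 0 → e 0 + e 0 ≤ n := by
      intro n hn
      have h : (n - e 0) 0 ≠ 0 := by
        intro h; simp [h] at hn
      intro k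
      by_cases hk : k = 0
      · subst hk
        simp [e] at h ⊢
        omega
      · simp [e, Ne.symm hk]
    have h := add_right_cancel (add_right_cancel hab)
    rw [tsub_tsub, tsub_tsub] at h
    rw [← tsub_add_cancel_of_le (two a ha), h, tsub_add_cancel_of_le (two b hb)]

theorem boundedOp_wStar {d N : ℕ} (φ : ℝ) (j : Mode d) (ψ : FockN d N) (c : Config d N) :
    boundedOp N (wStarFormal N φ j) ψ c = act (wStarFormal N φ j) ψ c := by
  let e : Mode d → Occ d := fun k => Finsupp.single k 1
  refine boundedOp_spec (exists_bounded _
    (fun n => ((φ / N : ℝ) : ℂ) * ((Real.sqrt (n 0 + 1) : ℂ) *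
      ((Real.sqrt ((n + e 0) 0 + 1) : ℂ) * ((Real.sqrt ((n + e 0 + e 0) j) : ℂ) *
        (Real.sqrt ((n + e 0 + e 0 - e j) (-j)) : ℂ)))))
    (fun n => n + e 0 + e 0 - e j - e (-j))
    (|φ / N| * (Real.sqrt (N + 2) * (Real.sqrt (N + 2) * (Real.sqrt (N + 2) *
      Real.sqrt (N + 2))))) ?_ ?_ ?_) ψ c
  · intro ψ n
    simp only [wStarFormal, creat, annih, LinearMap.smul_apply, Module.End.mul_apply,
      LinearMap.coe_mk, AddHom.coe_mk, Pi.smul_apply, smul_eq_mul, e]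
    ring
  · intro c
    have he : ∀ k, e 0 k ≤ 1 := by
      intro k
      simp only [e, Finsupp.single_apply]; split_ifs <;> simp
    have h0 : c.1 0 ≤ N := le_of_config c 0
    have h1 : (c.1 + e 0) 0 ≤ N + 1 := by
      have := he 0
      rw [Finsupp.add_apply]; omega
    have h2 : ∀ k, (c.1 + e 0 + e 0) k ≤ N + 2 := by
      intro k
      have := he k
      have := le_of_config c k
      rw [Finsupp.add_apply, Finsupp.add_apply]; omega
    have h3 : (c.1 + e 0 + e 0 - e j) (-j) ≤ N + 2 :=
      ((tsub_le_self : c.1 + e 0 + e 0 - e j ≤ _) (-j)).trans (h2 (-j))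
    have h0' : ((c.1 0 : ℕ) : ℝ) ≤ N := by exact_mod_cast h0
    have h1' : (((c.1 + e 0) 0 : ℕ) : ℝ) ≤ N + 1 := by exact_mod_cast h1
    have h2' : (((c.1 + e 0 + e 0) j : ℕ) : ℝ) ≤ N + 2 := by exact_mod_cast h2 j
    have h3' : (((c.1 + e 0 + e 0 - e j) (-j) : ℕ) : ℝ) ≤ N + 2 := by exact_mod_cast h3
    simp only [norm_mul, Complex.norm_real, Real.norm_eq_abs, abs_of_nonneg (Real.sqrt_nonneg _)]
    have g0 := Real.sqrt_le_sqrt (show ((c.1 0 : ℕ) : ℝ) + 1 ≤ N + 2 by linarith)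
    have g1 := Real.sqrt_le_sqrt (show (((c.1 + e 0) 0 : ℕ) : ℝ) + 1 ≤ N + 2 by linarith)
    have g2 := Real.sqrt_le_sqrt h2'
    have g3 := Real.sqrt_le_sqrt h3'
    exact mul_le_mul_of_nonneg_left (mul_le_mul g0 (mul_le_mul g1 (mul_le_mul g2 g3
      (by positivity) (by positivity)) (by positivity) (by positivity)) (by positivity)
      (by positivity)) (abs_nonneg _)
  · intro a ha b hb hab
    have two : ∀ n : Occ d, (((φ / N : ℝ) : ℂ) * ((Real.sqrt (n 0 + 1) : ℂ) *
        ((Real.sqrt ((n + e 0) 0 + 1) : ℂ) * ((Real.sqrt ((n + e 0 + e 0) j) : ℂ) *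
        (Real.sqrt ((n + e 0 + e 0 - e j) (-j)) : ℂ))))) ≠ 0 → e j + e (-j) ≤ n + e 0 + e 0 := by
      intro n hn
      have hj : (n + e 0 + e 0) j ≠ 0 := by
        intro h; simp [-Finsupp.coe_add, -Pi.add_apply, h] at hn
      have hj' : (n + e 0 + e 0 - e j) (-j) ≠ 0 := by
        intro h; simp [-Finsupp.coe_add, -Finsupp.coe_tsub, h] at hn
      have l1 : e j ≤ n + e 0 + e 0 := by
        simp only [e, Finsupp.single_le_iff] at hj ⊢
        omega
      have l2 : e (-j) ≤ n + e 0 + e 0 - e j := by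
        simp only [e, Finsupp.single_le_iff] at hj' ⊢
        omega
      exact (add_le_add le_rfl l2).trans (add_tsub_cancel_of_le l1).le
    simp only [tsub_tsub] at hab
    have h : a + e 0 + e 0 = b + e 0 + e 0 := by
      rw [← tsub_add_cancel_of_le (two a ha), hab, tsub_add_cancel_of_le (two b hb)]
    exact add_right_cancel (add_right_cancel h)

/-! ### The Feshbach–Schur map -/

section Feshbach

variable {E : Type*} [NormedAddCommGroup E] [InnerProductSpace ℂ E]

/-- `B` is the (bounded, everywhere defined) inverse of `Pb K Pb` on the range of the projection
`Pb`, extended by zero to the complement: `B = Pb (Pb K Pb)⁻¹ Pb`. -/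
def IsReducedInverse (Pb : E →L[ℂ] E) (K : E →ₗ.[ℂ] E) (B : E →L[ℂ] E) : Prop :=
  (∀ ψ, Pb (B ψ) = B ψ) ∧ (∀ ψ, B (Pb ψ) = B ψ) ∧
  (∀ ψ, ∃ h : B ψ ∈ K.domain, Pb (K ⟨B ψ, h⟩) = Pb ψ) ∧
  (∀ ψ, ∀ h : Pb ψ ∈ K.domain, B (Pb (K ⟨Pb ψ, h⟩)) = Pb ψ)

/-- `Pb K Pb` is bounded invertible on the range of `Pb`. -/
def BoundedInvertibleOn (Pb : E →L[ℂ] E) (K : E →ₗ.[ℂ] E) : Prop :=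
  ∃ B : E →L[ℂ] E, IsReducedInverse Pb K B

/-- `Pb (Pb K Pb)⁻¹ Pb` (junk value `0` if `Pb K Pb` is not bounded invertible). -/
def reducedInverse (Pb : E →L[ℂ] E) (K : E →ₗ.[ℂ] E) : E →L[ℂ] E := by
  classical
  exact if h : BoundedInvertibleOn Pb K then h.choose else 0

theorem reducedInverse_mem (Pb : E →L[ℂ] E) (K : E →ₗ.[ℂ] E) (ψ : E) :
    reducedInverse Pb K ψ ∈ K.domain := by
  unfold reducedInverse
  split_ifs with h
  · exact (h.choose_spec.2.2.1 ψ).1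
  · simp

/-- The Feshbach–Schur map `P K P - P K Pb (Pb K Pb)⁻¹ Pb K P`, as an operator on the whole space
which vanishes on the kernel of `P`; its domain is `{ψ : P ψ ∈ D(K)}`. -/
def feshbach (P Pb : E →L[ℂ] E) (K : E →ₗ.[ℂ] E) : E →ₗ.[ℂ] E where
  domain := K.domain.comap (P : E →ₗ[ℂ] E)
  toFun :=
    { toFun := fun ψ => P (K ⟨P ψ, ψ.2⟩) -
        P (K ⟨reducedInverse Pb K (Pb (K ⟨P ψ, ψ.2⟩)), reducedInverse_mem Pb K _⟩)
      map_add' := by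
        intro ψ χ
        have h1 : K ⟨P (ψ + χ : K.domain.comap (P : E →ₗ[ℂ] E)), (ψ + χ).2⟩
            = K ⟨P ψ, ψ.2⟩ + K ⟨P χ, χ.2⟩ := by
          refine Eq.trans ?_ (LinearPMap.map_add K _ _)
          refine congrArg K.toFun (Subtype.ext ?_)
          simp
        simp only [h1]
        have h2 : K ⟨reducedInverse Pb K (Pb (K ⟨P ψ, ψ.2⟩ + K ⟨P χ, χ.2⟩)),
              reducedInverse_mem Pb K _⟩
            = K ⟨reducedInverse Pb K (Pb (K ⟨P ψ, ψ.2⟩)), reducedInverse_mem Pb K _⟩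
              + K ⟨reducedInverse Pb K (Pb (K ⟨P χ, χ.2⟩)), reducedInverse_mem Pb K _⟩ := by
          refine Eq.trans ?_ (LinearPMap.map_add K _ _)
          refine congrArg K.toFun (Subtype.ext ?_)
          simp
        rw [h2, map_add, map_add]
        abel
      map_smul' := by
        intro r ψ
        have h1 : K ⟨P (r • ψ : K.domain.comap (P : E →ₗ[ℂ] E)), (r • ψ).2⟩
            = r • K ⟨P ψ, ψ.2⟩ := by
          refine Eq.trans ?_ (LinearPMap.map_smul K _ _)
          refine congrArg K.toFun (Subtype.ext ?_)
          simp
        simp only [h1]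
        have h2 : K ⟨reducedInverse Pb K (Pb (r • K ⟨P ψ, ψ.2⟩)), reducedInverse_mem Pb K _⟩
            = r • K ⟨reducedInverse Pb K (Pb (K ⟨P ψ, ψ.2⟩)), reducedInverse_mem Pb K _⟩ := by
          refine Eq.trans ?_ (LinearPMap.map_smul K _ _)
          refine congrArg K.toFun (Subtype.ext ?_)
          simp
        rw [h2, map_smul, map_smul, RingHom.id_apply, smul_sub] }

end Feshbach

/-! ### The Feshbach–Schur flow of the three-modes Hamiltonian -/

section Flow

variable {d : ℕ} (N : ℕ) (L φ : ℝ) (js : Mode d)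

/-- `H^{Bog}_{j⋆} - z` on the `N`-particle space. -/
def hBogSub (z : ℝ) : FockN d N →ₗ.[ℂ] FockN d N :=
  realize N (hBogFormal N L φ js - (z : ℂ) • (1 : FormalOp d))

/-- `W_{j⋆}` on the `N`-particle space. -/
def W : FockN d N →L[ℂ] FockN d N := boundedOp N (wFormal N φ js)

/-- `W_{j⋆}^*` on the `N`-particle space. -/
def Wst : FockN d N →L[ℂ] FockN d N := boundedOp N (wStarFormal N φ js)

/-- `Q^{(i,i+1)}`: exactly `N - i` or `N - i - 1` particles in the modes `± j⋆`. -/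
def Q (i : ℕ) : FockN d N →L[ℂ] FockN d N :=
  boundedOp N (cutFormal {n | pairNum js n + i = N ∨ pairNum js n + i + 1 = N})

/-- `Q^{(>i+1)}`: less than `N - i - 1` particles in the modes `± j⋆`. -/
def Qgt (i : ℕ) : FockN d N →L[ℂ] FockN d N :=
  boundedOp N (cutFormal {n | pairNum js n + i + 1 < N})

/-- `flow (t + 1) = 𝒦^{Bog (2t)}(z)`, and `flow 0 = 𝒦^{Bog (-2)}(z) = H^{Bog}_{j⋆} - z`. -/
def flow (z : ℝ) : ℕ → (FockN d N →ₗ.[ℂ] FockN d N)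
  | 0 => hBogSub N L φ js z
  | t + 1 => feshbach (Qgt N js (2 * t)) (Q N js (2 * t)) (flow z t)

/-- `R^{Bog}_{i,i}(z) = Q^{(i,i+1)} (Q^{(i,i+1)} (H^{Bog}_{j⋆} - z) Q^{(i,i+1)})⁻¹ Q^{(i,i+1)}`. -/
def R (z : ℝ) (i : ℕ) : FockN d N →L[ℂ] FockN d N :=
  reducedInverse (Q N js i) (hBogSub N L φ js z)

/-- `W_{i,i'} = Q^{(i,i+1)} W Q^{(i',i'+1)}`. -/
def Wii (i i' : ℕ) : FockN d N →L[ℂ] FockN d N := Q N js i * W N φ js * Q N js i'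

/-- `W^*_{i,i'} = Q^{(i,i+1)} W^* Q^{(i',i'+1)}`. -/
def Wstii (i i' : ℕ) : FockN d N →L[ℂ] FockN d N := Q N js i * Wst N φ js * Q N js i'

/-- `Gam z t = Γ^{Bog}_{2t,2t}(z)`. With the value `0` at `t = 0` the recursion gives
`Γ_{2,2} = W_{2,0} R_{0,0} W^*_{0,2}`. -/
def Gam (z : ℝ) : ℕ → (FockN d N →L[ℂ] FockN d N)
  | 0 => 0
  | t + 1 => Wii N φ js (2 * t + 2) (2 * t) * R N L φ js z (2 * t)
      * (∑' l : ℕ, (Gam z t * R N L φ js z (2 * t)) ^ l) * Wstii N φ js (2 * t) (2 * t + 2)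

/-- `η`: all `N` particles in the zero mode. -/
def eta (d N : ℕ) : FockN d N :=
  lp.single 2 (⟨Finsupp.single 0 N, by simp⟩ : Config d N) (1 : ℂ)

/-- `𝒫_η = |η⟩⟨η|`. -/
def Peta (d N : ℕ) : FockN d N →L[ℂ] FockN d N := InnerProductSpace.rankOne ℂ (eta d N) (eta d N)

/-- The projection complementary to `𝒫_η` in the range of `Q^{(>N-1)}`. -/
def PetaBar : FockN d N →L[ℂ] FockN d N := Qgt N js (N - 2) - Peta d N

/-- `𝒦^{Bog (N-2)}(z)`. -/
def KNm2 (z : ℝ) : FockN d N →ₗ.[ℂ] FockN d N := flow N L φ js z (N / 2)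

/-- The final Feshbach–Schur Hamiltonian `𝒦^{Bog (N)}(z)`. -/
def KN (z : ℝ) : FockN d N →ₗ.[ℂ] FockN d N :=
  feshbach (Peta d N) (PetaBar N js) (KNm2 N L φ js z)

/-- `f(z) = -z - ⟨η, W R_{N-2,N-2}(z) ∑_l [Γ_{N-2,N-2}(z) R_{N-2,N-2}(z)]^l W^* η⟩`. -/
def fFun (z : ℝ) : ℂ :=
  -(z : ℂ) - ⟪eta d N, W N φ js (R N L φ js z (N - 2)
    ((∑' l : ℕ, (Gam N L φ js z (N / 2 - 1) * R N L φ js z (N - 2)) ^ l)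
      (Wst N φ js (eta d N))))⟫_ℂ

/-- All the inverses in `𝒦^{Bog (i)}(z)`, `i = 0, 2, …, N - 2`, and all the resolvents and Neumann
series in `f(z)` exist. -/
def FlowWellDefined (z : ℝ) : Prop :=
  ∀ t < N / 2,
    BoundedInvertibleOn (Q N js (2 * t)) (flow N L φ js z t) ∧
    BoundedInvertibleOn (Q N js (2 * t)) (hBogSub N L φ js z) ∧
    Summable fun l : ℕ => (Gam N L φ js z t * R N L φ js z (2 * t)) ^ l

/-- `ε = k_{j⋆}² / φ`. -/
def eps : ℝ := kSq L js / φ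

/-- `E^{Bog}_{j⋆} = -[k² + φ - √((k²)² + 2 φ k²)]`. -/
def eBog : ℝ :=
  -(kSq L js + φ - Real.sqrt ((kSq L js) ^ 2 + 2 * φ * kSq L js))

/-- `E^{Bog}_{j⋆} + √ε φ √(ε² + 2ε)`. -/
def zMax : ℝ :=
  eBog L φ js + Real.sqrt (eps L φ js) * φ * Real.sqrt ((eps L φ js) ^ 2 + 2 * eps L φ js)

end Flow

end BogThreeModes

end

open BogThreeModes

/-! In the occupation number basis `H` conserves every occupation number outside the modes `0, ±
j⋆`, and also the difference of the occupations of `j⋆` and `-j⋆`. Configurations therefore split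
into finite chains, along which pairs move between the zero mode and `± j⋆`, and on each chain `H -
z` is a Jacobi matrix. A pair move changes the pair number by two, whereas a shell `Q^{(i,i+1)}`
contains two consecutive pair numbers, so a chain meets a shell at most once. One Feshbach–Schur
step is thus one step of Gaussian elimination on all chains at once, starting from the end with the
most pairs (`PivotsBounded.isTridiag_feshbach`). Its pivots satisfy `κ = D - z - w² / κ_up`
(`sectorPivot_eq`). Likewise `Γ` is diagonal with entries `w² / κ_up`, `R ∑ (Γ R)^l` acts as `1 / κ`
on its shell, and `f(z)` is the pivot at `η` (`PivotsBounded.fFun_eq`).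

What remains is scalar. Put `e = √ε`, `s = √(ε² + 2ε)`, `x = 1 + ε - s`, and let `v` be the rest
energy minus `z`, divided by `φ`; then `z ≤ z_max` gives `v ≥ x - e s`.

Existence of the flow: an explicit subsolution of the pivot recursion (`BogParam.pivot_ge`) keeps
every pivot with at least one particle in `± j⋆` above a positive constant.

The zero of `f`: the pivot at `η` is continuous in `v`, grows with slope at least one
(`BogParam.pivot_mono`), and is negative at the threshold by a variational estimate with the trial
vector `x^m` (`BogParam.pivot_neg`). So it has exactly one zero.

Invertibility on the complement of `η`: a configuration without particles in `± j⋆` other than `η`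
has `M ≤ N` particles in the zero mode and rest energy at least `Δ₀`. Decreasing `M` does not lower
the pivot (`BogParam.pivot_antitone`), so slope one leaves a margin `Δ₀ / 2` for `z < z⋆ + Δ₀ / 2`.
Since `𝒦^{(N-2)}` is diagonal, the last Feshbach map just reads off the entry at `η`. -/

namespace BogThreeModes

/-! ### Scalar pivots and their lower bound at and above the threshold. -/

/-- Schur complements (pivots) of the tridiagonal matrix obtained from the three-modes Hamiltonian
in units of `φ`, with `n` particles in the zero mode and `a`, `b` particles in the modes `± j⋆`. -/
noncomputable def pivot (N ε v : ℝ) : ℕ → ℕ → ℕ → ℝ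
  | 0, a, b => ε * (a + b) + v
  | 1, a, b => (ε + 1 / N) * (a + b) + v
  | n + 2, a, b => (ε + (n + 2) / N) * (a + b) + v
      - (n + 2) * (n + 1) * (a + 1) * (b + 1) / N ^ 2 / pivot N ε v n (a + 1) (b + 1)

/-- One recursion for all `n`: for `n = 0, 1` the factor `n (n - 1)` vanishes, so the truncated `n -
2` does no harm. -/
theorem pivot_eq (N ε v : ℝ) (n a b : ℕ) :
    pivot N ε v n a b = (ε + n / N) * (a + b) + v
      - n * (n - 1) * (a + 1) * (b + 1) / N ^ 2 / pivot N ε v (n - 2) (a + 1) (b + 1) := by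
  match n with
  | 0 => simp [pivot]
  | 1 => simp [pivot]
  | n + 2 =>
    rw [pivot]
    push_cast
    rw [show (n : ℝ) + 2 - 1 = n + 1 by ring]

/-- The parameters `e = √ε`, `s = √(ε² + 2ε)` and `x = 1 + ε - s` for small `ε`. -/
structure BogParam (e s x : ℝ) : Prop where
  e_pos : 0 < e
  e_le : e ≤ 1 / 10
  s_pos : 0 < s
  s_sq : s ^ 2 = e ^ 4 + 2 * e ^ 2
  x_eq : x = 1 + e ^ 2 - s

namespace BogParam

variable {e s x : ℝ}

theorem s_ge (h : BogParam e s x) : 7 / 5 * e ≤ s := by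
  refine le_of_sq_le_sq ?_ h.s_pos.le
  have := h.e_pos
  nlinarith [h.s_sq, sq_nonneg (e ^ 2)]

theorem s_le (h : BogParam e s x) : s ≤ 3 / 2 * e := by
  have := h.e_pos
  refine le_of_sq_le_sq ?_ (by positivity)
  have h1 : e ^ 2 ≤ 1 / 100 := by nlinarith [h.e_le]
  nlinarith [h.s_sq, sq_nonneg e]

theorem x_ge (h : BogParam e s x) : 17 / 20 ≤ x := by
  have := h.s_le; have := h.e_le; have := h.x_eq
  nlinarith [sq_nonneg e]

theorem x_lt (h : BogParam e s x) : x < 1 := by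
  have := h.s_ge; have := h.e_le; have := h.x_eq; have := h.e_pos
  nlinarith [sq_nonneg e]

/-- `x` is the smaller root of `x² - 2 (1 + ε) x + 1 = 0`, the decay rate of the limiting recursion;
the other root is `1 / x`. -/
theorem x_mul (h : BogParam e s x) : x * (2 + 2 * e ^ 2 - x) = 1 := by
  rw [h.x_eq]; linear_combination -h.s_sq

theorem inv_x (h : BogParam e s x) : 1 / x = 2 + 2 * e ^ 2 - x := by
  have := h.x_ge
  rw [div_eq_iff (by linarith)]
  linarith [h.x_mul]

theorem es_le (h : BogParam e s x) : e * s ≤ 3 / 200 := by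
  have := h.s_le; have := h.e_le; have := h.e_pos
  nlinarith

/-- The induction step of `pivot_ge`, with `q = n / N`, `t = 1 / N`, `p = a + b`. The bracket
multiplied by `q` is the bound of `div_le` for the eliminated term at `A = (p + 2) / 2`; `p * t ≤ 1
- q` says that there are at most `N` particles. -/
theorem pivot_step (h : BogParam e s x) {p q t : ℝ} (hp : 1 ≤ p) (hq : 0 ≤ q)
    (ht : 0 ≤ t) (hpt : p * t ≤ 1 - q) :
    (q + t) * (p / (2 * x) - e) ≤ (e ^ 2 + q) * p + (x - e * s)
      - q * (x * ((p + 2) / 2) + e * x ^ 2 + 3 / 4 * e ^ 2) := by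
  have hx := h.x_ge
  have h1 := h.x_lt
  have he := h.e_pos
  have hq1 : q ≤ 1 := by nlinarith
  have hd : p / (2 * x) = p / 2 * (2 + 2 * e ^ 2 - x) := by
    rw [← h.inv_x]; field_simp
  rw [hd]
  set y := 2 + 2 * e ^ 2 - x with hy
  have hxy : x * y = 1 := h.x_mul
  have hy2 : y ≤ 118 / 100 := by
    nlinarith
  have hes := h.es_le
  have hsx : 1 - x ^ 2 = 2 * s * x := by
    have e1 := h.x_eq
    have e2 := h.s_sq
    subst e1
    linear_combination e2
  -- The difference of the two sides is bounded below by the nonnegative pieces `k2`, `k3`, `k4`,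
  -- once `p t` is replaced by `1 - q`. In `k3` the shift `-e` of the comparison sequence, through
  -- `1 - x² = 2 s x`, pays for the part `e s` by which the threshold is lowered.
  have k1 : p * t * y / 2 ≤ (1 - q) * (59 / 100) := by
    have : 0 ≤ p * t := by positivity
    nlinarith
  have k2 : 0 ≤ p * e ^ 2 * (1 - q) := by
    have : 0 ≤ 1 - q := by linarith
    positivity
  have k3 : 0 ≤ q * e * (2 * s * x - s - 3 / 4 * e) := by
    have : 0 ≤ 2 * s * x - s - 3 / 4 * e := by
      have := h.s_ge
      nlinarith
    positivity
  have k4 : 0 ≤ (1 - q) * (x - 59 / 100 - e * s) := by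
    apply mul_nonneg <;> linarith
  have k5 : 0 ≤ t * e := by positivity
  have k6 : q * e * (1 - x ^ 2) = q * e * (2 * s * x) := by rw [hsx]
  nlinarith

/-- Second-order expansion of `A² / (A / x - e)` in `e`. The coefficient `3 / 4` suffices because `3
/ 4 * (3 / 2)` exceeds `1 + 3 / 4 * (1 / 10)`. -/
theorem div_le (h : BogParam e s x) {A : ℝ} (hA : 3 / 2 ≤ A) :
    A ^ 2 / (A / x - e) ≤ x * A + e * x ^ 2 + 3 / 4 * e ^ 2 := by
  have hx := h.x_ge
  have h1 := h.x_lt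
  have he := h.e_pos
  have he2 := h.e_le
  have hA1 : A ≤ A / x := by
    rw [le_div_iff₀ (by linarith)]; nlinarith
  rw [div_le_iff₀ (by linarith)]
  have e1 : A / x * x = A := div_mul_cancel₀ _ (by linarith)
  have e2 : (x * A + e * x ^ 2 + 3 / 4 * e ^ 2) * (A / x - e) - A ^ 2
      = e ^ 2 * (3 / 4 * (A / x) - x ^ 2 - 3 / 4 * e) := by
    linear_combination (A + e * x) * e1
  have : 0 ≤ e ^ 2 * (3 / 4 * (A / x) - x ^ 2 - 3 / 4 * e) := by
    have : x ^ 2 ≤ 1 := by nlinarith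
    apply mul_nonneg (sq_nonneg e)
    linarith
  linarith

theorem comparison_pos (h : BogParam e s x) {p : ℝ} (hp : 1 ≤ p) : 2 / 5 ≤ p / (2 * x) - e := by
  have hx := h.x_ge
  have h1 := h.x_lt
  have he2 := h.e_le
  have : p / 2 ≤ p / (2 * x) := by
    apply div_le_div_of_nonneg_left <;> linarith
  linarith

/-- Lower bound for the pivots below the threshold, by an explicit comparison sequence. -/
theorem pivot_ge (h : BogParam e s x) {N v : ℝ} (hN : 0 < N) (hv : x - e * s ≤ v) (n : ℕ) :
    ∀ a b : ℕ, 1 ≤ a + b → (n : ℝ) + a + b ≤ N →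
    (n + 1) / N * ((a + b) / (2 * x) - e) + (v - (x - e * s)) ≤ pivot N (e ^ 2) v n a b := by
  induction n using Nat.strong_induction_on with
  | _ n ih =>
  intro a b hab hle
  have hx := h.x_ge
  have he := h.e_pos
  have hp : (1 : ℝ) ≤ a + b := by exact_mod_cast hab
  have hstep := h.pivot_step (p := a + b) (q := n / N) (t := 1 / N) hp (by positivity)
    (by positivity) (by
      rw [le_sub_iff_add_le]
      rw [show ((a : ℝ) + b) * (1 / N) + n / N = (n + a + b) / N by ring]
      exact div_le_one_of_le₀ hle hN.le)
  rw [← add_div] at hstep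
  rw [pivot_eq]
  suffices hw : (n : ℝ) * (n - 1) * (a + 1) * (b + 1) / N ^ 2
      / pivot N (e ^ 2) v (n - 2) (a + 1) (b + 1)
      ≤ n / N * (x * ((a + b + 2) / 2) + e * x ^ 2 + 3 / 4 * e ^ 2) by linarith
  have hrhs : 0 ≤ (n : ℝ) / N * (x * ((a + b + 2) / 2) + e * x ^ 2 + 3 / 4 * e ^ 2) := by
    positivity
  match n, ih with
  | 0, _ => simp
  | 1, _ => simpa using hrhs
  | n + 2, ih =>
    have hi := ih n (by omega) (a + 1) (b + 1) (by omega) (by push_cast at hle ⊢; linarith)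
    have hc := h.comparison_pos (p := a + b + 2) (by linarith)
    push_cast at hi ⊢
    rw [show (a : ℝ) + 1 + (b + 1) = a + b + 2 by ring] at hi
    have hG : (n + 1) / N * ((a + b + 2 : ℝ) / (2 * x) - e)
        ≤ pivot N (e ^ 2) v n (a + 1) (b + 1) := by linarith
    have hGpos : 0 < (n + 1) / N * ((a + b + 2 : ℝ) / (2 * x) - e) := by
      have : 0 < (a + b + 2 : ℝ) / (2 * x) - e := by linarith
      positivity
    have hd := h.div_le (A := (a + b + 2) / 2) (by linarith)
    -- By AM–GM the bound depends on `a + b` only. The prefactor `(n + 1) / N` of the comparison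
    -- sequence is chosen to cancel the factor `n + 1` of the squared hop.
    have hab4 : ((a : ℝ) + 1) * (b + 1) ≤ ((a + b + 2) / 2) ^ 2 := by
      nlinarith [sq_nonneg ((a : ℝ) - b)]
    calc ((n : ℝ) + 2) * (n + 2 - 1) * (a + 1) * (b + 1) / N ^ 2
          / pivot N (e ^ 2) v n (a + 1) (b + 1)
        ≤ ((n : ℝ) + 2) * (n + 1) * ((a + b + 2) / 2) ^ 2 / N ^ 2
          / ((n + 1) / N * ((a + b + 2 : ℝ) / (2 * x) - e)) := by
          apply div_le_div₀ (by positivity) _ hGpos hG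
          apply div_le_div_of_nonneg_right _ (by positivity)
          rw [show (n : ℝ) + 2 - 1 = n + 1 by ring, mul_assoc]
          gcongr
      _ = (n + 2) / N * (((a + b + 2) / 2) ^ 2 / ((a + b + 2) / 2 / x - e)) := by
          have : ((a + b + 2 : ℝ) / (2 * x) - e) ≠ 0 := by linarith
          rw [show (a + b + 2 : ℝ) / 2 / x = (a + b + 2) / (2 * x) by field_simp]
          have h2 : (n : ℝ) + 1 ≠ 0 := by positivity
          generalize (a + b + 2 : ℝ) / (2 * x) - e = y at *
          field_simp
      _ ≤ _ := by gcongr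

theorem pivot_pos (h : BogParam e s x) {N v : ℝ} (hN : 0 < N) (hv : x - e * s ≤ v) {n a b : ℕ}
    (hab : 1 ≤ a + b) (hle : (n : ℝ) + a + b ≤ N) :
    1 / N * (2 / 5) + (v - (x - e * s)) ≤ pivot N (e ^ 2) v n a b := by
  refine le_trans ?_ (h.pivot_ge hN hv n a b hab hle)
  have hc := h.comparison_pos (p := a + b) (by exact_mod_cast hab)
  have : 1 / N * (2 / 5) ≤ (n + 1) / N * (((a : ℝ) + b) / (2 * x) - e) := by
    gcongr
    linarith [(n.cast_nonneg : (0 : ℝ) ≤ n)]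
  linarith

/-- The explicit term `v` contributes slope one, and increasing the next pivot only shrinks what is
subtracted. -/
theorem pivot_mono (h : BogParam e s x) {N v v' : ℝ} (hN : 0 < N) (hv : x - e * s ≤ v)
    (hvv : v ≤ v') (n : ℕ) : ∀ a b : ℕ, (n : ℝ) + a + b ≤ N →
    pivot N (e ^ 2) v n a b + (v' - v) ≤ pivot N (e ^ 2) v' n a b := by
  induction n using Nat.strong_induction_on with
  | _ n ih =>
  intro a b hle
  rw [pivot_eq, pivot_eq N (e ^ 2) v']
  match n, ih with
  | 0, _ => simp
  | 1, _ => simp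
  | n + 2, ih =>
    have hle' : (n : ℝ) + (a + 1 : ℕ) + (b + 1 : ℕ) ≤ N := by push_cast at hle ⊢; linarith
    have hi := ih n (by omega) (a + 1) (b + 1) hle'
    have hpos := h.pivot_pos hN hv (by omega : 1 ≤ (a + 1) + (b + 1)) hle'
    have hN' : 0 < 1 / N := by positivity
    rw [Nat.add_sub_cancel]
    have : ((n + 2 : ℕ) : ℝ) * ((n + 2 : ℕ) - 1) * (a + 1) * (b + 1) / N ^ 2
          / pivot N (e ^ 2) v' n (a + 1) (b + 1)
        ≤ ((n + 2 : ℕ) : ℝ) * ((n + 2 : ℕ) - 1) * (a + 1) * (b + 1) / N ^ 2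
          / pivot N (e ^ 2) v n (a + 1) (b + 1) := by
      apply div_le_div_of_nonneg_left _ (by linarith) (by linarith)
      have : (0 : ℝ) ≤ ((n + 2 : ℕ) : ℝ) - 1 := by push_cast; linarith [n.cast_nonneg (α := ℝ)]
      positivity
    linarith

theorem pivot_continuousOn (h : BogParam e s x) {N : ℝ} (hN : 0 < N) (n : ℕ) :
    ∀ a b : ℕ, (n : ℝ) + a + b ≤ N →
    ContinuousOn (fun v => pivot N (e ^ 2) v n a b) (Set.Ici (x - e * s)) := by
  induction n using Nat.strong_induction_on with
  | _ n ih =>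
  intro a b hle
  match n, ih with
  | 0, _ => simp only [pivot]; fun_prop
  | 1, _ => simp only [pivot]; fun_prop
  | n + 2, ih =>
    have hle' : (n : ℝ) + (a + 1 : ℕ) + (b + 1 : ℕ) ≤ N := by push_cast at hle ⊢; linarith
    have hi := ih n (by omega) (a + 1) (b + 1) hle'
    simp only [pivot]
    refine ContinuousOn.sub (by fun_prop) (ContinuousOn.div continuousOn_const hi ?_)
    intro v hv
    have hpos := h.pivot_pos hN hv (by omega : 1 ≤ (a + 1) + (b + 1)) hle'
    have hN' : 0 < 1 / N := by positivity
    have : x - e * s ≤ v := hv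
    linarith

end BogParam
-- Pivots and quadratic forms of Jacobi matrices.
section QuadForm

variable {D w κ : ℕ → ℝ}

/-- The quadratic form of a Jacobi matrix with positive pivots `κ 1, κ 2, …` is at least `κ 0` times
the square of the first component. -/
theorem pivot_mul_sq_le_quadForm (hκ : ∀ m, κ m = D m - w m ^ 2 / κ (m + 1))
    (hpos : ∀ m, 0 < κ (m + 1)) (ψ : ℕ → ℝ) (k : ℕ) :
    κ 0 * ψ 0 ^ 2 ≤ ∑ m ∈ Finset.range k, (D m * ψ m ^ 2 - 2 * w m * ψ m * ψ (m + 1))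
      + κ k * ψ k ^ 2 := by
  induction k with
  | zero => simp
  | succ k ih =>
    rw [Finset.sum_range_succ]
    have h0 := hpos k
    have h1 : D k = κ k + w k ^ 2 / κ (k + 1) := by rw [hκ k]; ring
    have h2 : (w k ^ 2 / κ (k + 1)) * ψ k ^ 2 - 2 * w k * ψ k * ψ (k + 1)
        + κ (k + 1) * ψ (k + 1) ^ 2 = (w k * ψ k - κ (k + 1) * ψ (k + 1)) ^ 2 / κ (k + 1) := by
      field_simp
      ring
    have h3 : 0 ≤ (w k * ψ k - κ (k + 1) * ψ (k + 1)) ^ 2 / κ (k + 1) := by positivity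
    rw [h1]
    linarith

/-- Equality case of the preceding bound: this vector makes every completed square vanish. -/
theorem quadForm_eq_pivot_mul_sq (hκ : ∀ m, κ m = D m - w m ^ 2 / κ (m + 1))
    (hpos : ∀ m, 0 < κ (m + 1)) {ψ : ℕ → ℝ} (hψ : ∀ m, ψ (m + 1) = ψ m * (w m / κ (m + 1)))
    (k : ℕ) :
    ∑ m ∈ Finset.range k, (D m * ψ m ^ 2 - 2 * w m * ψ m * ψ (m + 1))
      + κ k * ψ k ^ 2 = κ 0 * ψ 0 ^ 2 := by
  induction k with
  | zero => simp
  | succ k ih =>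
    rw [Finset.sum_range_succ, ← ih, hκ k, hψ k]
    have h0 := (hpos k).ne'
    field_simp
    ring

end QuadForm

/-! ### Chains with equally many particles in `j⋆` and `-j⋆`. -/

/-- Diagonal entries in the sector with `M` particles in the modes `0, ± j⋆` and equally many
particles in `j⋆` and `-j⋆`. -/
noncomputable def chainDiag (N ε v : ℝ) (M m : ℕ) : ℝ :=
  (ε + ((M - 2 * m : ℕ) : ℝ) / N) * (m + m) + v

/-- Absolute values of the off-diagonal entries in that sector. -/
noncomputable def chainHop (N : ℝ) (M m : ℕ) : ℝ :=
  √(((M - 2 * m : ℕ) : ℝ) * (((M - 2 * m : ℕ) : ℝ) - 1)) * (m + 1) / N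

theorem natCast_mul_sub_one_nonneg (n : ℕ) : (0 : ℝ) ≤ n * ((n : ℝ) - 1) := by
  rcases Nat.eq_zero_or_pos n with h | h
  · simp [h]
  · have : (1 : ℝ) ≤ n := by exact_mod_cast h
    exact mul_nonneg (by linarith) (by linarith)

theorem chainHop_sq (N : ℝ) (M m : ℕ) : chainHop N M m ^ 2 =
    ((M - 2 * m : ℕ) : ℝ) * (((M - 2 * m : ℕ) : ℝ) - 1) * (m + 1) * (m + 1) / N ^ 2 := by
  rw [chainHop, div_pow, mul_pow, Real.sq_sqrt (natCast_mul_sub_one_nonneg _)]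
  ring

theorem chain_pivot_eq (N ε v : ℝ) (M m : ℕ) : pivot N ε v (M - 2 * m) m m =
    chainDiag N ε v M m - chainHop N M m ^ 2 / pivot N ε v (M - 2 * (m + 1)) (m + 1) (m + 1) := by
  rw [pivot_eq, chainHop_sq, chainDiag, show M - 2 * m - 2 = M - 2 * (m + 1) by omega]

theorem chainHop_nonneg {N : ℝ} (hN : 0 < N) (M m : ℕ) : 0 ≤ chainHop N M m := by
  unfold chainHop; positivity

theorem chainHop_eq_zero (N : ℝ) {M m : ℕ} (h : M < 2 * m + 2) : chainHop N M m = 0 := by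
  have : M - 2 * m = 0 ∨ M - 2 * m = 1 := by omega
  rcases this with h | h <;> simp [chainHop, h]

/-- The function `y ↦ √(y (y - 1))` grows at least as fast as `y`, since it stays below `y - 1 / 2`.
-/
theorem sqrt_mul_sub_one_add_le {y z : ℝ} (hy : 1 ≤ y) (hz : y ≤ z) :
    √(y * (y - 1)) + (z - y) ≤ √(z * (z - 1)) := by
  have h1 : √(y * (y - 1)) ≤ y - 1 / 2 :=
    Real.sqrt_le_iff.mpr ⟨by linarith, by nlinarith⟩
  apply Real.le_sqrt_of_sq_le
  have h2 := Real.sq_sqrt (show 0 ≤ y * (y - 1) by nlinarith)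
  nlinarith

theorem sub_one_le_sqrt_mul_sub_one (n : ℕ) : (n : ℝ) - 1 ≤ √(n * ((n : ℝ) - 1)) := by
  rcases Nat.eq_zero_or_pos n with h | h
  · simp [h]
  · have : (1 : ℝ) ≤ n := by exact_mod_cast h
    exact Real.le_sqrt_of_sq_le (by nlinarith)

/-! ### Sign and monotonicity of the pivot at the bottom of a chain. -/

namespace BogParam

variable {e s x : ℝ}

theorem threshold_ge (h : BogParam e s x) : 4 / 5 ≤ x - e * s := by
  linarith [h.x_ge, h.es_le]

theorem chain_pivot_pos (h : BogParam e s x) {N v : ℝ} (hN : 0 < N) (hv : x - e * s ≤ v) {M : ℕ}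
    (hM : M ≤ N) (m : ℕ) : 0 < pivot N (e ^ 2) v (M - 2 * (m + 1)) (m + 1) (m + 1) := by
  by_cases hm : 2 * (m + 1) ≤ M
  · have := h.pivot_pos hN hv (n := M - 2 * (m + 1)) (a := m + 1) (b := m + 1) (by omega) (by
      rw [Nat.cast_sub hm]; push_cast; linarith)
    have hN' : 0 < 1 / N := by positivity
    linarith
  -- Beyond the end of the chain the truncated subtraction gives a spurious but positive pivot,
  -- decoupled because the hop vanishes.
  · rw [show M - 2 * (m + 1) = 0 by omega, pivot]
    have := h.threshold_ge
    have : 0 < v := by linarith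
    positivity

/-- The ground state energy of the sector without particles outside the modes `0, ± j⋆` lies below
the threshold. -/
theorem pivot_neg (h : BogParam e s x) {N : ℕ} (hN : 100 ≤ N * e ^ 3) :
    pivot N (e ^ 2) (x - e * s) N 0 0 < 0 := by
  have he := h.e_pos
  have hx := h.x_ge
  have hx1 := h.x_lt
  have hs := h.s_pos
  have hN0 : (0 : ℝ) < N := by
    by_contra hc
    have : (N : ℝ) = 0 := le_antisymm (not_lt.mp hc) N.cast_nonneg
    rw [this] at hN; norm_num at hN
  -- Trial vector `x^m`, with the off-diagonal signs absorbed in the minus sign of the form.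
  have key := pivot_mul_sq_le_quadForm (chain_pivot_eq N (e ^ 2) (x - e * s) N)
    (h.chain_pivot_pos hN0 le_rfl le_rfl) (fun m => x ^ m) (N / 2)
  have hlast : pivot N (e ^ 2) (x - e * s) (N - 2 * (N / 2)) (N / 2) (N / 2)
      = chainDiag N (e ^ 2) (x - e * s) N (N / 2) := by
    rw [chain_pivot_eq, chainHop_eq_zero _ (by omega)]; simp
  have hsum : ∑ m ∈ Finset.range (N / 2), (chainDiag N (e ^ 2) (x - e * s) N m * (x ^ m) ^ 2
        - 2 * chainHop N N m * x ^ m * x ^ (m + 1))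
      + pivot N (e ^ 2) (x - e * s) (N - 2 * (N / 2)) (N / 2) (N / 2) * (x ^ (N / 2)) ^ 2
      = ∑ m ∈ Finset.range (N / 2 + 1), (chainDiag N (e ^ 2) (x - e * s) N m
        - 2 * chainHop N N m * x) * (x ^ 2) ^ m := by
    rw [Finset.sum_range_succ, hlast, chainHop_eq_zero (N : ℝ) (M := N) (m := N / 2) (by omega)]
    congr 1
    · refine Finset.sum_congr rfl fun m _ => ?_
      ring
    · ring
  have hsx : 1 - x ^ 2 = 2 * s * x := by
    rw [h.x_eq]; linear_combination h.s_sq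
  have hxy : x * (1 / x) = 1 := by field_simp
  set y := 1 / x with hy
  have hyx : y = 2 + 2 * e ^ 2 - x := h.inv_x
  -- With `y = 1 / x`, the part without `1 / N` is `y (m (1 - x²) - x²) - e s`, and the `1 / N`
  -- error is at most `(6 m + 2) / N`. Since `1 - x² = 2 s x`, the growing error `6 m / N` is a
  -- multiple of `m (1 - x²)` and joins the telescoping combination; only a constant is left over.
  have hcoef : ∀ m ∈ Finset.range (N / 2 + 1), (chainDiag N (e ^ 2) (x - e * s) N m
        - 2 * chainHop N N m * x) * (x ^ 2) ^ m
      ≤ ((y + 3 * y / (N * s)) * (m * (1 - x ^ 2) - x ^ 2) + (3 * x / (N * s) + 2 / N - e * s))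
        * (x ^ 2) ^ m := by
    intro m hm
    rw [Finset.mem_range] at hm
    refine mul_le_mul_of_nonneg_right ?_ (by positivity)
    have hn : ((N - 2 * m : ℕ) : ℝ) = N - 2 * m := by
      rw [Nat.cast_sub (by omega)]; push_cast; ring
    have hw : ((N : ℝ) - 2 * m - 1) * (m + 1) / N ≤ chainHop N N m := by
      rw [chainHop]
      have := sub_one_le_sqrt_mul_sub_one (N - 2 * m)
      rw [hn] at this ⊢
      gcongr
    have hw2 : 2 * (((N : ℝ) - 2 * m - 1) * (m + 1) / N) * x ≤ 2 * chainHop N N m * x := by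
      gcongr
    rw [chainDiag, hn]
    refine (sub_le_sub_left hw2 _).trans ?_
    have hm0 : (0 : ℝ) ≤ m := m.cast_nonneg
    have e1 : (e ^ 2 + ((N : ℝ) - 2 * m) / N) * (m + m) + (x - e * s)
        - 2 * (((N : ℝ) - 2 * m - 1) * (m + 1) / N) * x
        = m * (y - x) - x - e * s
          + (-(4 * m ^ 2 * (1 - x)) + 4 * m * x + 2 * (m + 1) * x) / N := by
      rw [hyx]; field_simp; ring
    have e2 : (y + 3 * y / (N * s)) * (m * (1 - x ^ 2) - x ^ 2)
          + (3 * x / (N * s) + 2 / N - e * s)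
        = m * (y - x) - x - e * s + (6 * m + 2) / N := by
      have : 3 * y / (N * s) * (m * (1 - x ^ 2)) = 6 * m / N := by
        rw [hsx, hy]; field_simp; ring
      rw [add_mul, mul_sub (3 * y / (N * s)), this]
      have e3 : 3 * y / (N * s) * x ^ 2 = 3 * x / (N * s) := by rw [hy]; field_simp
      rw [e3]
      linear_combination (-m * x - x) * hxy
    rw [e1, e2]
    have : (-(4 * m ^ 2 * (1 - x)) + 4 * m * x + 2 * (m + 1) * x : ℝ) / N ≤ (6 * m + 2) / N := by
      refine div_le_div_of_nonneg_right ?_ hN0.le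
      have : 0 ≤ 4 * (m : ℝ) ^ 2 * (1 - x) := by
        have : 0 ≤ 1 - x := by linarith
        positivity
      nlinarith
    linarith
  have htel : ∀ k : ℕ, ∑ m ∈ Finset.range k, ((m : ℝ) * (1 - x ^ 2) - x ^ 2) * (x ^ 2) ^ m
      = -(k * (x ^ 2) ^ k) := by
    intro k
    induction k with
    | zero => simp
    | succ k ih => rw [Finset.sum_range_succ, ih]; push_cast; ring
  -- After multiplication by `N s` this reads `3 x + 2 s < N e s²`; as `s` is of order `e`, it
  -- follows from `N e³ ≥ 100`.
  have hneg : 3 * x / (N * s) + 2 / N - e * s < 0 := by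
    have h1 : 3 * x / (N * s) + 2 / N = (3 * x + 2 * s) / (N * s) := by field_simp
    rw [h1, sub_neg, div_lt_iff₀ (by positivity)]
    have h2 := h.s_ge
    have h3 := h.s_le
    have h4 := h.e_le
    have h5 : 7 / 5 * (7 / 5) * e ^ 2 ≤ s * s := by nlinarith
    have h6 : N * e * (7 / 5 * (7 / 5) * e ^ 2) ≤ N * e * (s * s) := by gcongr
    nlinarith
  have hgeo : 1 ≤ ∑ m ∈ Finset.range (N / 2 + 1), (x ^ 2) ^ m := by
    rw [Finset.sum_range_succ', pow_zero]
    have : 0 ≤ ∑ k ∈ Finset.range (N / 2), (x ^ 2) ^ (k + 1) :=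
      Finset.sum_nonneg fun _ _ => by positivity
    linarith
  have hfin := Finset.sum_le_sum hcoef
  simp only [add_mul _ (3 * x / (N * s) + 2 / N - e * s)] at hfin
  rw [Finset.sum_add_distrib, ← Finset.mul_sum] at hfin
  simp only [mul_assoc (y + 3 * y / (N * s))] at hfin
  rw [← Finset.mul_sum, htel] at hfin
  have hy0 : 0 ≤ (y + 3 * y / (N * s)) * (((N / 2 + 1 : ℕ) : ℝ) * (x ^ 2) ^ (N / 2 + 1)) := by
    positivity
  simp only [mul_zero, Nat.sub_zero, pow_zero, one_pow, mul_one] at key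
  rw [hsum] at key
  nlinarith

/-- The pivots dominate the next off-diagonal entry; hence ground states decay monotonically in the
number of pairs. -/
theorem hop_le_pivot (h : BogParam e s x) {N v : ℝ} (hN : 5 ≤ N * e) (hv : x - e * s ≤ v) (n : ℕ) :
    ∀ m : ℕ, 1 ≤ m → (n : ℝ) + 2 * m ≤ N →
    m * √(((n : ℝ) + 2) * (n + 1)) / N ≤ pivot N (e ^ 2) v n m m := by
  have he := h.e_pos
  have hN0 : 0 < N := by by_contra hc; nlinarith
  have hx := h.x_ge
  have hx1 := h.x_lt
  have hth := h.threshold_ge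
  induction n using Nat.strong_induction_on with
  | _ n ih =>
  intro m hm hle
  have hm1 : (1 : ℝ) ≤ m := by exact_mod_cast hm
  have hn0 : (0 : ℝ) ≤ n := n.cast_nonneg
  have hsq : √(((n : ℝ) + 2) * (n + 1)) ≤ n + 3 / 2 :=
    Real.sqrt_le_iff.mpr ⟨by linarith, by nlinarith⟩
  -- In the first case and for `n ≥ 2`, induction bounds the eliminated term `w² / κ` by `w`, and
  -- the diagonal entry dominates the sum of the two adjacent hops; `n = 0, 1` are direct. In the
  -- second case `n` is so large that the comparison sequence suffices.
  by_cases hc : (n : ℝ) + m ≤ (x - e * s) * N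
  · have hcv : ((n : ℝ) + m) / N ≤ v := by
      rw [div_le_iff₀ hN0]; nlinarith
    match n, ih with
    | 0, _ =>
      have h2 : √((0 + 2) * (0 + 1) : ℝ) ≤ 3 / 2 :=
        Real.sqrt_le_iff.mpr ⟨by norm_num, by norm_num⟩
      have h3 : m * √((0 + 2) * (0 + 1) : ℝ) / N ≤ v := by
        rw [div_le_iff₀ hN0]
        push_cast at hle
        have h4 : m * √((0 + 2) * (0 + 1) : ℝ) ≤ m * (3 / 2) := by gcongr
        have h5 : 4 / 5 * N ≤ v * N := by gcongr; linarith
        refine h4.trans ?_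
        linarith
      have : 0 ≤ e ^ 2 * ((m : ℝ) + m) := by positivity
      simp only [pivot, Nat.cast_zero]
      linarith
    | 1, _ =>
      have h2 : √((1 + 2) * (1 + 1) : ℝ) ≤ 5 / 2 :=
        Real.sqrt_le_iff.mpr ⟨by norm_num, by norm_num⟩
      have h3 : m * √((1 + 2) * (1 + 1) : ℝ) / N ≤ 1 / N * (m + m) + v := by
        rw [div_le_iff₀ hN0]
        have : (1 / N * ((m : ℝ) + m) + v) * N = m + m + v * N := by field_simp
        rw [this]
        push_cast at hle
        have h4 : m * √((1 + 2) * (1 + 1) : ℝ) ≤ m * (5 / 2) := by gcongr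
        have h5 : 4 / 5 * N ≤ v * N := by gcongr; linarith
        refine h4.trans ?_
        linarith
      have : 0 ≤ e ^ 2 * ((m : ℝ) + m) := by positivity
      simp only [pivot, Nat.cast_one]
      linarith
    | n + 2, ih =>
      rw [pivot_eq, Nat.add_sub_cancel]
      have h1 : m * √((((n + 2 : ℕ) : ℝ) + 2) * ((n + 2 : ℕ) + 1)) / N
          ≤ m * ((n + 2 : ℕ) + 3 / 2) / N := by gcongr
      have e1 : (((n + 2 : ℕ) : ℝ) * (2 * m) + (n + 2 : ℕ) + m) / N
          = (n + 2 : ℕ) / N * (m + m) + ((n + 2 : ℕ) + m) / N := by ring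
      have he2 : 0 ≤ e ^ 2 * ((m : ℝ) + m) := by positivity
      have hi := ih n (by omega) (m + 1) (by omega) (by push_cast at hle ⊢; linarith)
      push_cast at hi h1 e1 hcv ⊢
      have hw0 : 0 < ((m : ℝ) + 1) * √(((n : ℝ) + 2) * (n + 1)) / N := by positivity
      have e2 : ((n : ℝ) + 2) * (n + 2 - 1) * (m + 1) * (m + 1) / N ^ 2
          = (((m : ℝ) + 1) * √(((n : ℝ) + 2) * (n + 1)) / N) ^ 2 := by
        rw [div_pow, mul_pow, Real.sq_sqrt (by positivity)]; ring
      rw [e2]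
      have h2 : (((m : ℝ) + 1) * √(((n : ℝ) + 2) * (n + 1)) / N) ^ 2
          / pivot N (e ^ 2) v n (m + 1) (m + 1)
          ≤ ((m : ℝ) + 1) * √(((n : ℝ) + 2) * (n + 1)) / N := by
        rw [div_le_iff₀ (by linarith), sq]
        gcongr
      have hsq' : √(((n : ℝ) + 2) * (n + 1)) ≤ n + 3 / 2 :=
        Real.sqrt_le_iff.mpr ⟨by positivity, by nlinarith⟩
      have h3 : ((m : ℝ) + 1) * √(((n : ℝ) + 2) * (n + 1)) / N ≤ (m + 1) * (n + 3 / 2) / N := by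
        gcongr
      have h4 : (m : ℝ) * (n + 2 + 3 / 2) / N + (m + 1) * (n + 3 / 2) / N
          ≤ ((n + 2) * (2 * m) + (n + 2) + m) / N := by
        rw [← add_div]
        refine div_le_div_of_nonneg_right ?_ hN0.le
        linarith
      linarith
  · have hg := h.pivot_ge hN0 hv n m m (by omega) (by linarith)
    rw [show ((m : ℝ) + m) / (2 * x) = m * (1 / x) by field_simp; ring, h.inv_x] at hg
    refine le_trans ?_ ((le_add_of_nonneg_right (by linarith)).trans hg)
    rw [div_mul_eq_mul_div]
    refine div_le_div_of_nonneg_right ?_ hN0.le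
    -- From `n + m > 4 N / 5` and `n + 2 m ≤ N`. Then `n e` is large enough for the excess of `1 / x
    -- - e` over `1`, of order `e`, to absorb the extra `1 / 2` in `n + 3 / 2`.
    have hn2 : 3 / 5 * N ≤ n := by nlinarith
    have h1 : 1 + 2 / 5 * e ≤ 2 + 2 * e ^ 2 - x - e := by
      have := h.s_ge; rw [h.x_eq]; nlinarith
    have h2 : (n : ℝ) + 3 / 2 ≤ (n + 1) * (1 + 2 / 5 * e) := by nlinarith
    have h3 : (m : ℝ) * (2 + 2 * e ^ 2 - x - e) ≤ m * (2 + 2 * e ^ 2 - x) - e := by nlinarith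
    calc (m : ℝ) * √(((n : ℝ) + 2) * (n + 1)) ≤ m * ((n + 1) * (1 + 2 / 5 * e)) := by
          gcongr; linarith
      _ ≤ m * ((n + 1) * (2 + 2 * e ^ 2 - x - e)) := by gcongr
      _ = (n + 1) * (m * (2 + 2 * e ^ 2 - x - e)) := by ring
      _ ≤ _ := by gcongr

/-- The ground state energy of the sector with `M` particles in the modes `0, ± j⋆` decreases
in `M`. -/
theorem pivot_antitone (h : BogParam e s x) {N : ℝ} {v : ℝ} {M M' : ℕ} (hN : 5 ≤ N * e)
    (hv : x - e * s ≤ v) (hM : M ≤ M') (hM' : M' ≤ N) :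
    pivot N (e ^ 2) v M' 0 0 ≤ pivot N (e ^ 2) v M 0 0 := by
  have he := h.e_pos
  have hN0 : 0 < N := by by_contra hc; nlinarith
  have hMN : (M : ℝ) ≤ N := le_trans (by exact_mod_cast hM) hM'
  have hp := h.chain_pivot_pos hN0 hv hMN
  have hp' := h.chain_pivot_pos hN0 hv hM'
  -- The vector for which the form of the chain `M` equals its first pivot; it is inserted as a
  -- trial vector into the form of the chain `M'`.
  let ψ : ℕ → ℝ := fun m => ∏ i ∈ Finset.range m,
    (chainHop N M i / pivot N (e ^ 2) v (M - 2 * (i + 1)) (i + 1) (i + 1))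
  have hψ : ∀ m, ψ (m + 1) = ψ m *
      (chainHop N M m / pivot N (e ^ 2) v (M - 2 * (m + 1)) (m + 1) (m + 1)) := fun m => by
    simp only [ψ, Finset.prod_range_succ]
  have hψ0 : ψ 0 = 1 := by simp [ψ]
  have hpsi_nonneg : ∀ m, 0 ≤ ψ m := fun m => Finset.prod_nonneg fun i _ =>
    div_nonneg (chainHop_nonneg hN0 _ _) (hp i).le
  have hvan : ∀ m, M < 2 * m → ψ m = 0 := by
    intro m hm
    obtain ⟨k, rfl⟩ : ∃ k, m = k + 1 := ⟨m - 1, by omega⟩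
    by_cases hk : M < 2 * k + 2
    · rw [hψ, chainHop_eq_zero _ hk]; simp
    · omega
  have hanti : ∀ m, ψ (m + 1) ≤ ψ m := by
    intro m
    rw [hψ]
    refine mul_le_of_le_one_right (hpsi_nonneg m) ?_
    rw [div_le_one (hp m)]
    by_cases hm : M < 2 * m + 2
    · rw [chainHop_eq_zero _ hm]; exact (hp m).le
    · have hc : ((M - 2 * (m + 1) : ℕ) : ℝ) = M - 2 * (m + 1) := by
        rw [Nat.cast_sub (by omega)]; push_cast; ring
      have hc' : ((M - 2 * m : ℕ) : ℝ) = M - 2 * m := by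
        rw [Nat.cast_sub (by omega)]; push_cast; ring
      have := h.hop_le_pivot hN hv (M - 2 * (m + 1)) (m + 1) (by omega) (by
        rw [hc]; push_cast; linarith)
      refine le_trans (le_of_eq ?_) this
      rw [chainHop, hc, hc']
      push_cast
      rw [mul_comm (√_)]
      congr 4 <;> ring
  have h1 := quadForm_eq_pivot_mul_sq (chain_pivot_eq N (e ^ 2) v M) hp hψ (M + 1)
  have h2 := pivot_mul_sq_le_quadForm (chain_pivot_eq N (e ^ 2) v M') hp' ψ (M + 1)
  rw [hvan (M + 1) (by omega), hψ0] at h1 h2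
  simp only [mul_zero, Nat.sub_zero, ne_eq, OfNat.ofNat_ne_zero, not_false_eq_true, zero_pow,
    add_zero, one_pow, mul_one] at h1 h2
  rw [← h1]
  refine h2.trans ?_
  -- Passing from `M` to `M'` raises the diagonal entry by `2 m (M' - M) / N` and the hop by at
  -- least `(m + 1) (M' - M) / N`. As `ψ` is nonincreasing, `ψ m * ψ (m + 1)` may be replaced by `ψ
  -- (m + 1) ^ 2`, so the total change is bounded by a telescoping sum.
  have hterm : ∀ m ∈ Finset.range (M + 1),
      chainDiag N (e ^ 2) v M' m * ψ m ^ 2 - 2 * chainHop N M' m * ψ m * ψ (m + 1)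
      ≤ chainDiag N (e ^ 2) v M m * ψ m ^ 2 - 2 * chainHop N M m * ψ m * ψ (m + 1)
        + ((M' : ℝ) - M) / N * (2 * m * ψ m ^ 2 - 2 * (m + 1 : ℕ) * ψ (m + 1) ^ 2) := by
    intro m _
    by_cases hm : M < 2 * m
    · rw [hvan m hm, hvan (m + 1) (by omega)]; simp
    have hc : ((M - 2 * m : ℕ) : ℝ) = M - 2 * m := by
      rw [Nat.cast_sub (by omega)]; push_cast; ring
    have hc' : ((M' - 2 * m : ℕ) : ℝ) = M' - 2 * m := by
      rw [Nat.cast_sub (by omega)]; push_cast; ring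
    have hMM : (M : ℝ) ≤ M' := by exact_mod_cast hM
    have hd : chainDiag N (e ^ 2) v M' m
        = chainDiag N (e ^ 2) v M m + ((M' : ℝ) - M) / N * (2 * m) := by
      rw [chainDiag, chainDiag, hc, hc']; ring
    have ho : ((M' : ℝ) - M) / N * (m + 1 : ℕ) * ψ (m + 1) ^ 2
        ≤ (chainHop N M' m - chainHop N M m) * (ψ m * ψ (m + 1)) := by
      by_cases hm2 : M < 2 * m + 2
      · rw [hvan (m + 1) (by omega)]; simp
      have h3 := sqrt_mul_sub_one_add_le (y := (M : ℝ) - 2 * m) (z := (M' : ℝ) - 2 * m) (by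
        have : ((2 * m + 2 : ℕ) : ℝ) ≤ M := by exact_mod_cast not_lt.mp hm2
        push_cast at this; linarith) (by linarith)
      have h4 : ((M' : ℝ) - M) / N * (m + 1 : ℕ) ≤ chainHop N M' m - chainHop N M m := by
        rw [chainHop, chainHop, hc, hc', ← sub_div, ← sub_mul, div_mul_eq_mul_div]
        push_cast
        refine div_le_div_of_nonneg_right ?_ hN0.le
        refine mul_le_mul_of_nonneg_right ?_ (by positivity)
        linarith
      have h5 : ψ (m + 1) ^ 2 ≤ ψ m * ψ (m + 1) := by
        rw [sq]; exact mul_le_mul_of_nonneg_right (hanti m) (hpsi_nonneg _)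
      have h6 : 0 ≤ ((M' : ℝ) - M) / N * (m + 1 : ℕ) :=
        mul_nonneg (div_nonneg (by linarith) hN0.le) (Nat.cast_nonneg _)
      exact mul_le_mul h4 h5 (sq_nonneg _) (h6.trans h4)
    rw [hd]
    linarith
  refine (Finset.sum_le_sum hterm).trans ?_
  rw [Finset.sum_add_distrib, ← Finset.mul_sum]
  have htel : ∑ m ∈ Finset.range (M + 1), (2 * (m : ℝ) * ψ m ^ 2 - 2 * (m + 1 : ℕ) * ψ (m + 1) ^ 2)
      = 0 := by
    rw [Finset.sum_range_sub' (fun m : ℕ => 2 * (m : ℝ) * ψ m ^ 2), hvan (M + 1) (by omega)]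
    simp
  rw [htel]
  simp

end BogParam
-- Moving pairs between the zero mode and `± j⋆`.
section Config

variable {d N : ℕ}

theorem extend_config (ψ : Config d N → ℂ) (c : Config d N) : extend ψ c.1 = ψ c := by
  show dite _ _ _ = _
  rw [dif_pos c.2]

theorem mode_ne_neg {js : Mode d} (hjs : js ≠ 0) : js ≠ -js := by
  intro h
  apply hjs
  ext i
  have := congrFun h i
  simp only [Pi.neg_apply, Pi.zero_apply] at *
  omega

theorem mode_neg_ne_zero {js : Mode d} (hjs : js ≠ 0) : -js ≠ 0 := neg_ne_zero.mpr hjs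

theorem occSum_add_single (n : Occ d) (j : Mode d) :
    ((n + Finsupp.single j 1).sum fun _ m => m) = (n.sum fun _ m => m) + 1 := by
  rw [Finsupp.sum_add_index' (fun _ => rfl) (fun _ _ _ => rfl), Finsupp.sum_single_index rfl]

theorem occ_sub_add_single {n : Occ d} {j : Mode d} (h : n j ≠ 0) :
    n - Finsupp.single j 1 + Finsupp.single j 1 = n := by
  apply tsub_add_cancel_of_le
  rw [Finsupp.single_le_iff]
  omega

theorem occSum_sub_single {n : Occ d} {j : Mode d} (h : n j ≠ 0) :
    ((n - Finsupp.single j 1).sum fun _ m => m) + 1 = n.sum fun _ m => m := by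
  rw [← occSum_add_single, occ_sub_add_single h]

/-- Two particles are moved from the zero mode to the modes `± js`. -/
noncomputable def pairUpOcc (js : Mode d) (n : Occ d) : Occ d :=
  n - Finsupp.single 0 1 - Finsupp.single 0 1 + Finsupp.single js 1 + Finsupp.single (-js) 1

/-- Two particles are moved from the modes `± js` to the zero mode. -/
noncomputable def pairDownOcc (js : Mode d) (n : Occ d) : Occ d :=
  n + Finsupp.single 0 1 + Finsupp.single 0 1 - Finsupp.single js 1 - Finsupp.single (-js) 1

variable {js : Mode d}

theorem pairUpOcc_zero (hjs : js ≠ 0) (n : Occ d) : pairUpOcc js n 0 = n 0 - 2 := by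
  simp [pairUpOcc, hjs, Nat.sub_sub]

theorem pairUpOcc_js (hjs : js ≠ 0) (n : Occ d) : pairUpOcc js n js = n js + 1 := by
  simp [pairUpOcc, hjs.symm, (mode_ne_neg hjs).symm]

theorem pairUpOcc_neg (hjs : js ≠ 0) (n : Occ d) : pairUpOcc js n (-js) = n (-js) + 1 := by
  simp [pairUpOcc, (mode_neg_ne_zero hjs).symm, (mode_ne_neg hjs)]

theorem pairDownOcc_js (hjs : js ≠ 0) (n : Occ d) : pairDownOcc js n js = n js - 1 := by
  simp [pairDownOcc, hjs.symm, (mode_ne_neg hjs).symm]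

theorem pairDownOcc_neg (hjs : js ≠ 0) (n : Occ d) : pairDownOcc js n (-js) = n (-js) - 1 := by
  simp [pairDownOcc, (mode_neg_ne_zero hjs).symm, (mode_ne_neg hjs)]

theorem pairUpOcc_of_ne {n : Occ d} {j : Mode d} (h0 : j ≠ 0) (h1 : j ≠ js) (h2 : j ≠ -js) :
    pairUpOcc js n j = n j := by
  simp [pairUpOcc, h0.symm, h1.symm, h2.symm]

theorem occSum_pairUpOcc {n : Occ d} (h : 2 ≤ n 0) :
    ((pairUpOcc js n).sum fun _ m => m) = n.sum fun _ m => m := by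
  rw [pairUpOcc, occSum_add_single, occSum_add_single, occSum_sub_single, occSum_sub_single]
  · omega
  · simp; omega

theorem occSum_pairDownOcc (hjs : js ≠ 0) {n : Occ d} (h : 1 ≤ n js) (h' : 1 ≤ n (-js)) :
    ((pairDownOcc js n).sum fun _ m => m) = n.sum fun _ m => m := by
  have h1 := occSum_sub_single (n := n + Finsupp.single 0 1 + Finsupp.single 0 1) (j := js)
    (by simp; omega)
  have h2 := occSum_sub_single
    (n := n + Finsupp.single 0 1 + Finsupp.single 0 1 - Finsupp.single js 1) (j := -js)
    (by simp [Finsupp.single_apply, mode_ne_neg hjs]; omega)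
  rw [occSum_add_single, occSum_add_single] at h1
  rw [pairDownOcc]
  omega

theorem pairDownOcc_pairUpOcc {n : Occ d} (h : 2 ≤ n 0) : pairDownOcc js (pairUpOcc js n) = n := by
  have h1 : n - Finsupp.single 0 1 - Finsupp.single 0 1 + Finsupp.single 0 1 + Finsupp.single 0 1
      = n := by
    rw [occ_sub_add_single, occ_sub_add_single]
    · omega
    · simp; omega
  rw [pairDownOcc, pairUpOcc, tsub_tsub]
  apply tsub_eq_of_eq_add
  conv_rhs => rw [← h1]
  generalize n - Finsupp.single 0 1 - Finsupp.single 0 1 = m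
  generalize Finsupp.single (-js) 1 = a
  abel

variable (js) in
/-- `pairUpOcc` on `N`-particle configurations. -/
noncomputable def pairUp (c : Config d N) : Config d N :=
  if h : 2 ≤ c.1 0 then ⟨pairUpOcc js c.1, (occSum_pairUpOcc h).trans c.2⟩ else c

open Classical in
variable (js) in
/-- `pairDownOcc` on `N`-particle configurations. -/
noncomputable def pairDown (c : Config d N) : Config d N :=
  if h : ((pairDownOcc js c.1).sum fun _ m => m) = N then ⟨pairDownOcc js c.1, h⟩ else c

theorem pairUp_val {c : Config d N} (h : 2 ≤ c.1 0) : (pairUp js c).1 = pairUpOcc js c.1 := by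
  rw [pairUp, dif_pos h]

theorem pairDown_val (hjs : js ≠ 0) {c : Config d N} (h : 1 ≤ c.1 js) (h' : 1 ≤ c.1 (-js)) :
    (pairDown js c).1 = pairDownOcc js c.1 := by
  rw [pairDown, dif_pos ((occSum_pairDownOcc hjs h h').trans c.2)]

theorem pairDown_pairUp (hjs : js ≠ 0) {c : Config d N} (h : 2 ≤ c.1 0) :
    pairDown js (pairUp js c) = c := by
  apply Subtype.ext
  have h1 := pairUp_val (js := js) h
  rw [pairDown_val hjs, h1, pairDownOcc_pairUpOcc h]
  · rw [h1, pairUpOcc_js hjs]; omega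
  · rw [h1, pairUpOcc_neg hjs]; omega

theorem pairNum_pairUp (hjs : js ≠ 0) {c : Config d N} (h : 2 ≤ c.1 0) :
    pairNum js (pairUp js c).1 = pairNum js c.1 + 2 := by
  rw [pairUp_val h, pairNum, pairUpOcc_js hjs, pairUpOcc_neg hjs, pairNum]
  omega

theorem pairNum_pairDown (hjs : js ≠ 0) {c : Config d N} (h : 1 ≤ c.1 js) (h' : 1 ≤ c.1 (-js)) :
    pairNum js (pairDown js c).1 + 2 = pairNum js c.1 := by
  rw [pairDown_val hjs h h', pairNum, pairDownOcc_js hjs, pairDownOcc_neg hjs, pairNum]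
  omega

theorem occ_add_pairNum_le (hjs : js ≠ 0) (c : Config d N) :
    c.1 0 + (c.1 js + c.1 (-js)) ≤ N := by
  classical
  have h : ∑ j ∈ {0, js, -js}, c.1 j ≤ N := by
    conv_rhs => rw [← c.2]
    rw [Finsupp.sum]
    apply Finset.sum_le_sum_of_ne_zero
    intro j _ hj
    exact Finsupp.mem_support_iff.mpr hj
  rw [Finset.sum_insert, Finset.sum_insert, Finset.sum_singleton] at h
  · exact h
  · simpa using mode_ne_neg hjs
  · simp [hjs.symm, (mode_neg_ne_zero hjs).symm]

theorem pairNum_le (hjs : js ≠ 0) (c : Config d N) : pairNum js c.1 ≤ N :=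
  (Nat.le_add_left _ _).trans (occ_add_pairNum_le hjs c)

end Config

/-! ### Matrix elements of the Hamiltonian and of the projections. -/

section Matrix

variable {d : ℕ} (N : ℕ) (L φ : ℝ) (js : Mode d)

/-- Matrix element of `W` between `n` and `pairUpOcc js n`. -/
noncomputable def hop (n : Occ d) : ℝ :=
  φ / N * √((n 0 : ℝ) * ((n 0 : ℝ) - 1) * (n js + 1) * (n (-js) + 1))

/-- Matrix element of `W^*` between `n` and `pairDownOcc js n`. -/
noncomputable def hopDown (n : Occ d) : ℝ :=
  φ / N * √(((n 0 : ℝ) + 2) * ((n 0 : ℝ) + 1) * n js * n (-js))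

/-- The kinetic energy of the particles outside the modes `± js`. -/
noncomputable def restEnergy (n : Occ d) : ℝ :=
  ∑ j ∈ n.support with j ≠ js ∧ j ≠ -js, kSq L j * n j

/-- Diagonal matrix elements of the Hamiltonian. -/
noncomputable def diagEnergy (n : Occ d) : ℝ :=
  restEnergy L js n + (kSq L js + φ / N * n 0) * (n js + n (-js))

variable {N L φ js}

theorem creat_mul_annih_apply (j : Mode d) (ψ : Occ d → ℂ) (n : Occ d) :
    (creat j * annih j) ψ n = n j * ψ n := by
  show (Real.sqrt (n j) : ℂ) * ((Real.sqrt ((n - Finsupp.single j 1 : Occ d) j + 1) : ℂ)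
    * ψ (n - Finsupp.single j 1 + Finsupp.single j 1)) = _
  by_cases h : n j = 0
  · simp [h]
  · rw [occ_sub_add_single h, ← mul_assoc, ← Complex.ofReal_mul]
    have : (((n - Finsupp.single j 1 : Occ d) j : ℕ) : ℝ) + 1 = n j := by
      have h2 : (n - Finsupp.single j 1 : Occ d) j + 1 = n j := by simp; omega
      exact_mod_cast h2
    rw [this, Real.mul_self_sqrt (Nat.cast_nonneg _)]
    simp

theorem kineticRest_apply (ψ : Occ d → ℂ) (n : Occ d) :
    kineticRest L js ψ n = restEnergy L js n * ψ n := by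
  show ∑ j ∈ n.support with j ≠ js ∧ j ≠ -js, (kSq L j : ℂ) * (creat j * annih j) ψ n = _
  simp only [creat_mul_annih_apply, restEnergy, Complex.ofReal_sum, Finset.sum_mul]
  refine Finset.sum_congr rfl fun j _ => ?_
  push_cast
  ring

theorem hZero_apply (ψ : Occ d → ℂ) (n : Occ d) :
    hZero N L φ js ψ n = ((kSq L js + φ / N * n 0) * (n js + n (-js)) : ℝ) * ψ n := by
  have h : ∀ (χ : Occ d → ℂ), ((kSq L js : ℂ) • (1 : FormalOp d)
      + ((φ / N : ℝ) : ℂ) • (creat 0 * annih 0) : FormalOp d) χ n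
      = (kSq L js + φ / N * n 0 : ℝ) * χ n := by
    intro χ
    have := creat_mul_annih_apply 0 χ n
    simp only [LinearMap.add_apply, LinearMap.smul_apply, Pi.add_apply, Pi.smul_apply, this,
      Module.End.one_apply, smul_eq_mul]
    push_cast
    ring
  refine (congrArg₂ (· + ·) (h _) (h _)).trans ?_
  rw [creat_mul_annih_apply, creat_mul_annih_apply]
  push_cast
  ring

theorem hop_eq_zero {n : Occ d} (h : n 0 < 2) : hop N φ js n = 0 := by
  have : n 0 = 0 ∨ n 0 = 1 := by omega
  rcases this with h | h <;> simp [hop, h]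

theorem two_le_of_hop {n : Occ d} (h : hop N φ js n ≠ 0) : 2 ≤ n 0 := by
  by_contra hc
  exact h (hop_eq_zero (by omega))

theorem one_le_of_hopDown {n : Occ d} (h : hopDown N φ js n ≠ 0) : 1 ≤ n js ∧ 1 ≤ n (-js) := by
  constructor <;> by_contra hc <;> apply h <;>
    simp [hopDown, Nat.lt_one_iff.mp (not_le.mp hc)]

theorem hopDown_pairUpOcc (hjs : js ≠ 0) {n : Occ d} (h : 2 ≤ n 0) :
    hopDown N φ js (pairUpOcc js n) = hop N φ js n := by
  rw [hopDown, hop, pairUpOcc_zero hjs, pairUpOcc_js hjs, pairUpOcc_neg hjs, Nat.cast_sub h]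
  push_cast
  congr 2
  ring

theorem hop_sq (n : Occ d) : hop N φ js n ^ 2 =
    φ ^ 2 * ((n 0 : ℝ) * ((n 0 : ℝ) - 1) * (n js + 1) * (n (-js) + 1) / N ^ 2) := by
  have h := natCast_mul_sub_one_nonneg (n 0)
  rw [hop, mul_pow, Real.sq_sqrt (by positivity)]
  ring

theorem act_wFormal (hjs : js ≠ 0) (ψ : FockN d N) (c : Config d N) :
    act (wFormal N φ js) ψ c = hop N φ js c.1 * ψ (pairUp js c) := by
  set e : Mode d → Occ d := fun k => Finsupp.single k 1 with he
  have h1 : act (wFormal N φ js) ψ c = ((φ / N : ℝ) : ℂ) * ((Real.sqrt (c.1 0) : ℂ) *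
      ((Real.sqrt ((c.1 - e 0) 0) : ℂ) * ((Real.sqrt ((c.1 - e 0 - e 0) js + 1) : ℂ) *
        ((Real.sqrt ((c.1 - e 0 - e 0 + e js) (-js) + 1) : ℂ)
          * extend (fun c' => ψ c') (pairUpOcc js c.1))))) := rfl
  rw [h1]
  by_cases h : 2 ≤ c.1 0
  · have h2 : extend (fun c' => ψ c') (pairUpOcc js c.1) = ψ (pairUp js c) := by
      rw [← pairUp_val h, extend_config]
    have h3 : (((c.1 - e 0) 0 : ℕ) : ℝ) = (c.1 0 : ℝ) - 1 := by
      have : (c.1 - e 0) 0 = c.1 0 - 1 := by simp [he]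
      rw [this, Nat.cast_sub (by omega), Nat.cast_one]
    have h4 : (c.1 - e 0 - e 0) js = c.1 js := by simp [he, hjs.symm]
    have h5 : (c.1 - e 0 - e 0 + e js) (-js) = c.1 (-js) := by
      simp [he, (mode_neg_ne_zero hjs).symm, mode_ne_neg hjs]
    have h6 : (1 : ℝ) ≤ c.1 0 := by exact_mod_cast (by omega : 1 ≤ c.1 0)
    have h7 : (0 : ℝ) ≤ (c.1 0 : ℝ) - 1 := by linarith
    rw [h2, h3, h4, h5, hop, Real.sqrt_mul (by positivity), Real.sqrt_mul (by positivity),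
      Real.sqrt_mul (by positivity)]
    push_cast
    ring
  · rw [hop_eq_zero (not_le.mp h)]
    have h0 : c.1 0 = 0 ∨ c.1 0 = 1 := by omega
    rcases h0 with h0 | h0
    · simp [h0]
    · have : (c.1 - e 0) 0 = 0 := by simp [he, h0]
      rw [this]; simp

theorem act_wStarFormal (hjs : js ≠ 0) (ψ : FockN d N) (c : Config d N) :
    act (wStarFormal N φ js) ψ c = hopDown N φ js c.1 * ψ (pairDown js c) := by
  set e : Mode d → Occ d := fun k => Finsupp.single k 1 with he
  have h1 : act (wStarFormal N φ js) ψ c = ((φ / N : ℝ) : ℂ) * ((Real.sqrt (c.1 0 + 1) : ℂ) *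
      ((Real.sqrt ((c.1 + e 0) 0 + 1) : ℂ) * ((Real.sqrt ((c.1 + e 0 + e 0) js) : ℂ) *
        ((Real.sqrt ((c.1 + e 0 + e 0 - e js) (-js)) : ℂ)
          * extend (fun c' => ψ c') (pairDownOcc js c.1))))) := rfl
  rw [h1]
  have h3 : (((c.1 + e 0) 0 : ℕ) : ℝ) + 1 = (c.1 0 : ℝ) + 2 := by
    have : (c.1 + e 0) 0 = c.1 0 + 1 := by simp [he]
    rw [this]; push_cast; ring
  have h4 : (c.1 + e 0 + e 0) js = c.1 js := by simp [he, hjs.symm]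
  have h5 : (c.1 + e 0 + e 0 - e js) (-js) = c.1 (-js) := by
    simp [he, (mode_neg_ne_zero hjs).symm, mode_ne_neg hjs]
  rw [h3, h4, h5, hopDown, Real.sqrt_mul (by positivity), Real.sqrt_mul (by positivity),
      Real.sqrt_mul (by positivity)]
  by_cases h : 1 ≤ c.1 js ∧ 1 ≤ c.1 (-js)
  · have h2 : extend (fun c' => ψ c') (pairDownOcc js c.1) = ψ (pairDown js c) := by
      rw [← pairDown_val hjs h.1 h.2, extend_config]
    rw [h2]
    push_cast
    ring
  · have h0 : c.1 js = 0 ∨ c.1 (-js) = 0 := by omega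
    rcases h0 with h0 | h0 <;> simp [h0]

theorem W_apply (hjs : js ≠ 0) (ψ : FockN d N) (c : Config d N) :
    W N φ js ψ c = hop N φ js c.1 * ψ (pairUp js c) := by
  rw [W, boundedOp_w, act_wFormal hjs]

theorem Wst_apply (hjs : js ≠ 0) (ψ : FockN d N) (c : Config d N) :
    Wst N φ js ψ c = hopDown N φ js c.1 * ψ (pairDown js c) := by
  rw [Wst, boundedOp_wStar, act_wStarFormal hjs]

theorem act_hBogSub (hjs : js ≠ 0) (z : ℝ) (ψ : FockN d N) (c : Config d N) :
    act (hBogFormal N L φ js - (z : ℂ) • (1 : FormalOp d)) ψ c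
      = ((diagEnergy N L φ js c.1 - z : ℝ) : ℂ) * ψ c + W N φ js ψ c + Wst N φ js ψ c := by
  rw [W_apply hjs, Wst_apply hjs, ← act_wFormal hjs, ← act_wStarFormal hjs]
  simp only [act, hBogFormal, LinearMap.sub_apply, LinearMap.add_apply, LinearMap.smul_apply,
    Pi.sub_apply, Pi.add_apply, Pi.smul_apply, Module.End.one_apply, kineticRest_apply,
    hZero_apply, extend_config, diagEnergy, smul_eq_mul]
  push_cast
  ring

theorem boundedOp_cut_apply (S : Set (Occ d)) {P : Prop} [Decidable P] (ψ : FockN d N)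
    {c : Config d N} (h : c.1 ∈ S ↔ P) :
    boundedOp N (cutFormal S) ψ c = if P then ψ c else 0 := by
  rw [boundedOp_cut]
  show S.indicator 1 c.1 * extend (fun c' => ψ c') c.1 = _
  rw [extend_config]
  by_cases hP : P
  · simp [hP, h.mpr hP]
  · simp [hP, mt h.mp hP]

theorem Q_apply (i : ℕ) (ψ : FockN d N) (c : Config d N) : Q N js i ψ c =
    if pairNum js c.1 + i = N ∨ pairNum js c.1 + i + 1 = N then ψ c else 0 := by
  exact boundedOp_cut_apply _ ψ Iff.rfl

theorem Qgt_apply (i : ℕ) (ψ : FockN d N) (c : Config d N) : Qgt N js i ψ c =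
    if pairNum js c.1 + i + 1 < N then ψ c else 0 := by
  exact boundedOp_cut_apply _ ψ Iff.rfl

end Matrix

/-! ### Diagonal operators. -/

section Diagonal

variable {d N : ℕ}

theorem memlp_mul {g : Config d N → ℂ} {C : ℝ} (hg : ∀ c, ‖g c‖ ≤ C) (ψ : FockN d N) :
    Memℓp (fun c => g c * ψ c) 2 := by
  refine ((lp.memℓp ψ).const_smul (C : ℂ)).mono' fun c => ?_
  rw [Pi.smul_apply, norm_smul, norm_mul]
  gcongr
  simpa using (hg c).trans (le_abs_self C)

/-- Bounded diagonal operators in the occupation number basis. -/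
theorem exists_diagonal {g : Config d N → ℂ} {C : ℝ} (hC : 0 ≤ C) (hg : ∀ c, ‖g c‖ ≤ C) :
    ∃ B : FockN d N →L[ℂ] FockN d N, ‖B‖ ≤ C ∧ ∀ ψ c, B ψ c = g c * ψ c := by
  let T : FockN d N →ₗ[ℂ] FockN d N :=
    { toFun := fun ψ => ⟨fun c => g c * ψ c, memlp_mul hg ψ⟩
      map_add' := fun ψ χ => by
        ext c
        show g c * (ψ c + χ c) = g c * ψ c + g c * χ c
        ring
      map_smul' := fun r ψ => by
        ext c
        show g c * (r * ψ c) = r * (g c * ψ c)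
        ring }
  refine ⟨T.mkContinuous C fun ψ => ?_, T.mkContinuous_norm_le hC _, fun ψ c => rfl⟩
  refine lp.norm_le_of_forall_sum_le (by simp) (by positivity) fun s => ?_
  have h := lp.sum_rpow_le_norm_rpow (p := 2) (by simp) ψ s
  simp only [ENNReal.toReal_ofNat, Real.rpow_ofNat] at h ⊢
  calc ∑ c ∈ s, ‖g c * ψ c‖ ^ 2 ≤ ∑ c ∈ s, C ^ 2 * ‖ψ c‖ ^ 2 := by
        refine Finset.sum_le_sum fun c _ => ?_
        rw [norm_mul, mul_pow]
        gcongr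
        exact hg c
    _ ≤ (C * ‖ψ‖) ^ 2 := by rw [← Finset.mul_sum, mul_pow]; gcongr

end Diagonal
-- Uniqueness of reduced inverses.
section ReducedInverse

variable {E : Type*} [NormedAddCommGroup E] [InnerProductSpace ℂ E]
  {P Pb : E →L[ℂ] E} {K : E →ₗ.[ℂ] E} {B B' : E →L[ℂ] E}

/-- Uniqueness makes the chosen `reducedInverse` computable: any explicit candidate that is a
reduced inverse is the chosen one. -/
theorem IsReducedInverse.unique (h : IsReducedInverse Pb K B) (h' : IsReducedInverse Pb K B') :
    B = B' := by
  ext ψ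
  obtain ⟨hd, hK⟩ := h.2.2.1 ψ
  have hB := h.1 ψ
  have hd' : Pb (B ψ) ∈ K.domain := by rw [hB]; exact hd
  have h1 := h'.2.2.2 (B ψ) hd'
  have h2 : K ⟨Pb (B ψ), hd'⟩ = K ⟨B ψ, hd⟩ := congrArg K.toFun (Subtype.ext hB)
  rw [h2, hK, h'.2.1, hB] at h1
  exact h1.symm

theorem IsReducedInverse.reducedInverse_eq (h : IsReducedInverse Pb K B) :
    reducedInverse Pb K = B := by
  have hex : BoundedInvertibleOn Pb K := ⟨B, h⟩
  rw [reducedInverse, dif_pos hex]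
  exact hex.choose_spec.unique h

theorem IsReducedInverse.feshbach_apply (h : IsReducedInverse Pb K B)
    (ψ : (feshbach P Pb K).domain) :
    ∃ (χ η : E) (hη : η ∈ K.domain), χ = K ⟨P ψ, ψ.2⟩ ∧ η = B (Pb χ) ∧
      feshbach P Pb K ψ = P χ - P (K ⟨η, hη⟩) := by
  obtain rfl := h.reducedInverse_eq
  exact ⟨_, _, reducedInverse_mem Pb K _, rfl, rfl, rfl⟩

end ReducedInverse

/-! ### Pivots of the Hamiltonian on configurations. -/

section Pivot

variable {d N : ℕ} {L φ z : ℝ} {js : Mode d}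

theorem kSq_zero : kSq L (0 : Mode d) = 0 := by simp [kSq]

theorem kSq_nonneg (j : Mode d) : 0 ≤ kSq L j := Finset.sum_nonneg fun _ _ => sq_nonneg _

theorem restEnergy_nonneg (n : Occ d) : 0 ≤ restEnergy L js n :=
  Finset.sum_nonneg fun j _ => mul_nonneg (kSq_nonneg j) (Nat.cast_nonneg _)

theorem restEnergy_eq_sum {n : Occ d} {T : Finset (Mode d)} (hT : n.support ⊆ T) :
    restEnergy L js n = ∑ j ∈ T with j ≠ js ∧ j ≠ -js, kSq L j * n j := by
  refine Finset.sum_subset (Finset.filter_subset_filter _ hT) fun j hj hj' => ?_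
  have : n j = 0 := by
    by_contra hn
    exact hj' (Finset.mem_filter.mpr ⟨Finsupp.mem_support_iff.mpr hn, (Finset.mem_filter.mp hj).2⟩)
  simp [this]

/-- The zero mode belongs to the sum and does lose particles, but at no kinetic energy. -/
theorem restEnergy_pairUpOcc (n : Occ d) :
    restEnergy L js (pairUpOcc js n) = restEnergy L js n := by
  classical
  rw [restEnergy_eq_sum (T := n.support ∪ (pairUpOcc js n).support) Finset.subset_union_right,
    restEnergy_eq_sum (T := n.support ∪ (pairUpOcc js n).support) Finset.subset_union_left]
  refine Finset.sum_congr rfl fun j hj => ?_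
  obtain ⟨-, h1, h2⟩ := Finset.mem_filter.mp hj
  by_cases h0 : j = 0
  · simp [h0, kSq_zero]
  · rw [pairUpOcc_of_ne h0 h1 h2]

/-- Schur complement of the Hamiltonian minus `z` at the configuration `n`, after elimination of all
configurations obtained from `n` by moving pairs from the zero mode to `± js`. -/
noncomputable def sectorPivot (N : ℕ) (L φ : ℝ) (js : Mode d) (z : ℝ) (n : Occ d) : ℝ :=
  φ * pivot N (eps L φ js) ((restEnergy L js n - z) / φ) (n 0) (n js) (n (-js))

/-- The recursion along a chain. With fewer than two particles in the zero mode `pairUp` is the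
identity by default, and the vanishing hop removes the term. -/
theorem sectorPivot_eq (hjs : js ≠ 0) (hφ : 0 < φ) (c : Config d N) :
    sectorPivot N L φ js z c.1 = diagEnergy N L φ js c.1 - z
      - hop N φ js c.1 ^ 2 / sectorPivot N L φ js z (pairUp js c).1 := by
  have hD : φ * ((eps L φ js + (c.1 0 : ℝ) / N) * ((c.1 js : ℝ) + c.1 (-js))
      + (restEnergy L js c.1 - z) / φ) = diagEnergy N L φ js c.1 - z := by
    rw [diagEnergy, eps]; field_simp; ring
  by_cases h : 2 ≤ c.1 0
  · have h1 : sectorPivot N L φ js z (pairUp js c).1 = φ * pivot N (eps L φ js)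
        ((restEnergy L js c.1 - z) / φ) (c.1 0 - 2) (c.1 js + 1) (c.1 (-js) + 1) := by
      rw [sectorPivot, pairUp_val h, restEnergy_pairUpOcc, pairUpOcc_zero hjs, pairUpOcc_js hjs,
        pairUpOcc_neg hjs]
    rw [h1, sectorPivot, pivot_eq, mul_sub, hD, hop_sq, sq φ, mul_assoc φ φ,
      mul_div_mul_left _ _ hφ.ne']
    exact congrArg _ (mul_div_assoc _ _ _).symm
  · rw [sectorPivot, pivot_eq, mul_sub, hD, hop_eq_zero (not_le.mp h)]
    have : c.1 0 = 0 ∨ c.1 0 = 1 := by omega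
    rcases this with h0 | h0 <;> simp [h0]

theorem hop_sq_le (c : Config d N) :
    hop N φ js c.1 ^ 2 ≤ φ ^ 2 * ((N : ℝ) * N * (N + 1) * (N + 1) / N ^ 2) := by
  rw [hop_sq]
  have h0 : (c.1 0 : ℝ) ≤ N := by exact_mod_cast le_of_config c 0
  have h1 : (c.1 js : ℝ) ≤ N := by exact_mod_cast le_of_config c js
  have h2 : (c.1 (-js) : ℝ) ≤ N := by exact_mod_cast le_of_config c (-js)
  have h3 : (c.1 0 : ℝ) * ((c.1 0 : ℝ) - 1) ≤ N * N := by nlinarith [(c.1 0).cast_nonneg (α := ℝ)]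
  gcongr

/-- The Schur complements are bounded from below on configurations with particles in `± js`. -/
def PivotsBounded (N : ℕ) (L φ : ℝ) (js : Mode d) (z δ : ℝ) : Prop :=
  0 < δ ∧ ∀ c : Config d N, 1 ≤ pairNum js c.1 → δ ≤ sectorPivot N L φ js z c.1

/-- Diagonal matrix elements of `Γ`. -/
noncomputable def gamEntry (N : ℕ) (L φ : ℝ) (js : Mode d) (z : ℝ) (c : Config d N) : ℝ :=
  hop N φ js c.1 ^ 2 / sectorPivot N L φ js z (pairUp js c).1

theorem sectorPivot_eq_sub_gamEntry (hjs : js ≠ 0) (hφ : 0 < φ) (c : Config d N) :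
    sectorPivot N L φ js z c.1 = diagEnergy N L φ js c.1 - z - gamEntry N L φ js z c :=
  sectorPivot_eq hjs hφ c

variable {δ : ℝ}

theorem PivotsBounded.gamEntry_nonneg (h : PivotsBounded N L φ js z δ) (hjs : js ≠ 0)
    (c : Config d N) : 0 ≤ gamEntry N L φ js z c := by
  rw [gamEntry]
  by_cases hc : 2 ≤ c.1 0
  · have h1 := h.2 (pairUp js c) (by rw [pairNum_pairUp hjs hc]; omega)
    have := h.1
    have : 0 < sectorPivot N L φ js z (pairUp js c).1 := by linarith
    positivity
  · simp [hop_eq_zero (not_le.mp hc)]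

/-- The bound is uniform in `c` although the diagonal energies are unbounded. Hence elimination
changes the diagonal by a bounded amount, which keeps domains under control and bounds the Neumann
series. -/
theorem PivotsBounded.gamEntry_le (h : PivotsBounded N L φ js z δ) (hjs : js ≠ 0)
    (c : Config d N) :
    gamEntry N L φ js z c ≤ φ ^ 2 * ((N : ℝ) * N * (N + 1) * (N + 1) / N ^ 2) / δ := by
  rw [gamEntry]
  have hδ := h.1
  by_cases hc : 2 ≤ c.1 0
  · have h1 := h.2 (pairUp js c) (by rw [pairNum_pairUp hjs hc]; omega)
    exact div_le_div₀ (by positivity) (hop_sq_le c) hδ h1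
  · simp only [hop_eq_zero (not_le.mp hc), ne_eq, OfNat.ofNat_ne_zero, not_false_eq_true, zero_pow,
      zero_div]
    positivity

end Pivot

/-! ### Tridiagonal operators on the chains. -/

section Tridiagonal

variable {d N : ℕ} {L φ z : ℝ} {js : Mode d}

/-- `c` lies in the range of `Q^{(2t, 2t+1)}`. -/
def InShell (N : ℕ) (js : Mode d) (t : ℕ) (c : Config d N) : Prop :=
  pairNum js c.1 + 2 * t = N ∨ pairNum js c.1 + 2 * t + 1 = N

instance (t : ℕ) (c : Config d N) : Decidable (InShell N js t c) :=
  inferInstanceAs (Decidable (_ ∨ _))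

theorem Q_two_mul_apply (t : ℕ) (ψ : FockN d N) (c : Config d N) :
    Q N js (2 * t) ψ c = if InShell N js t c then ψ c else 0 := Q_apply _ ψ c

/-- `K` is the restriction of `H - z` to configurations with at most `N - 2t` particles in `± js`,
with diagonal entries replaced by `g`. -/
structure IsTridiag (N : ℕ) (L φ : ℝ) (js : Mode d) (z : ℝ) (t : ℕ) (g : Config d N → ℝ)
    (K : FockN d N →ₗ.[ℂ] FockN d N) : Prop where
  mem_domain (ψ : FockN d N) : ψ ∈ K.domain ↔ Memℓp (fun c : Config d N =>
    if pairNum js c.1 + 2 * t ≤ N then ((diagEnergy N L φ js c.1 - z : ℝ) : ℂ) * ψ c else 0) 2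
  apply_eq (ψ : K.domain) (c : Config d N) : (K ψ : FockN d N) c =
    if pairNum js c.1 + 2 * t ≤ N then
      (g c : ℂ) * (ψ : FockN d N) c
        + hop N φ js c.1 * (if pairNum js (pairUp js c).1 + 2 * t ≤ N
            then (ψ : FockN d N) (pairUp js c) else 0)
        + hopDown N φ js c.1 * (ψ : FockN d N) (pairDown js c)
    else 0

/-- `W` and `W^*` are bounded, so the domain is that of the diagonal part. -/
theorem isTridiag_hBogSub (hjs : js ≠ 0) :
    IsTridiag N L φ js z 0 (fun c => diagEnergy N L φ js c.1 - z) (hBogSub N L φ js z) where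
  mem_domain ψ := by
    simp only [mul_zero, add_zero, pairNum_le hjs, if_true]
    have h : act (hBogFormal N L φ js - (z : ℂ) • (1 : FormalOp d)) ψ
        = (fun c : Config d N => ((diagEnergy N L φ js c.1 - z : ℝ) : ℂ) * ψ c)
          + ⇑(W N φ js ψ + Wst N φ js ψ) := by
      ext c
      rw [act_hBogSub hjs, Pi.add_apply, lp.coeFn_add, Pi.add_apply, add_assoc]
    show Memℓp (act _ ψ) 2 ↔ _
    rw [h]
    constructor
    · intro h1
      have h2 := h1.sub (lp.memℓp (W N φ js ψ + Wst N φ js ψ))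
      rwa [add_sub_cancel_right] at h2
    · intro h1
      exact h1.add (lp.memℓp _)
  apply_eq ψ c := by
    simp only [mul_zero, add_zero, pairNum_le hjs, if_true]
    show act _ ψ.1 c = _
    rw [act_hBogSub hjs, W_apply hjs, Wst_apply hjs]

variable {t u : ℕ} {g : Config d N → ℝ} {K : FockN d N →ₗ.[ℂ] FockN d N}

theorem IsTridiag.apply_mk (hK : IsTridiag N L φ js z t g K) {χ : FockN d N} (hχ : χ ∈ K.domain)
    (c : Config d N) : (K ⟨χ, hχ⟩ : FockN d N) c =
    if pairNum js c.1 + 2 * t ≤ N then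
      (g c : ℂ) * χ c
        + hop N φ js c.1 * (if pairNum js (pairUp js c).1 + 2 * t ≤ N
            then χ (pairUp js c) else 0)
        + hopDown N φ js c.1 * χ (pairDown js c)
    else 0 := hK.apply_eq ⟨χ, hχ⟩ c

theorem InShell.le {c : Config d N} (h : InShell N js u c) (htu : t ≤ u) :
    pairNum js c.1 + 2 * t ≤ N := by
  rcases h with h | h <;> omega

end Tridiagonal
-- The Feshbach–Schur flow as Gaussian elimination.
section Tridiagonal

variable {d N : ℕ} {L φ z δ : ℝ} {js : Mode d}
variable {t u : ℕ} {g : Config d N → ℝ} {K : FockN d N →ₗ.[ℂ] FockN d N}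

theorem InShell.not_pairUp (hjs : js ≠ 0) {c : Config d N} (h : InShell N js t c)
    (hc : hop N φ js c.1 ≠ 0) : ¬ pairNum js (pairUp js c).1 + 2 * t ≤ N := by
  rw [pairNum_pairUp hjs (two_le_of_hop hc)]
  rcases h with h | h <;> omega

theorem InShell.pairUp_iff (hjs : js ≠ 0) {c : Config d N} (hc : hop N φ js c.1 ≠ 0) :
    InShell N js t (pairUp js c) ↔ InShell N js (t + 1) c := by
  rw [InShell, InShell, pairNum_pairUp hjs (two_le_of_hop hc)]
  constructor <;> rintro (h | h) <;> omega

theorem hopDown_pairUp (hjs : js ≠ 0) {c : Config d N} (hc : hop N φ js c.1 ≠ 0) :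
    hopDown N φ js (pairUp js c).1 = hop N φ js c.1 := by
  rw [pairUp_val (two_le_of_hop hc), hopDown_pairUpOcc hjs (two_le_of_hop hc)]

theorem pairNum_pairDown_of_hopDown (hjs : js ≠ 0) {c : Config d N}
    (hc : hopDown N φ js c.1 ≠ 0) : pairNum js (pairDown js c).1 + 2 = pairNum js c.1 :=
  pairNum_pairDown hjs (one_le_of_hopDown hc).1 (one_le_of_hopDown hc).2

/-- Action of a tridiagonal operator on a vector supported in the top shell. -/
theorem IsTridiag.apply_of_shell (hK : IsTridiag N L φ js z t g K) (hjs : js ≠ 0)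
    (ψ : K.domain) (hψ : ∀ c, ¬ InShell N js u c → (ψ : FockN d N) c = 0) (htu : t ≤ u)
    {c : Config d N} (hc : InShell N js u c) :
    (K ψ : FockN d N) c = g c * (ψ : FockN d N) c := by
  rw [hK.apply_eq, if_pos (hc.le htu)]
  have h1 : (hop N φ js c.1 : ℂ) * (if pairNum js (pairUp js c).1 + 2 * t ≤ N
            then (ψ : FockN d N) (pairUp js c) else 0) = 0 := by
    by_cases h : hop N φ js c.1 = 0
    · simp [h]
    · have : ¬ InShell N js u (pairUp js c) := fun hs =>
        (hc.not_pairUp hjs h) (hs.le le_rfl)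
      simp [hψ _ this]
  have h2 : (hopDown N φ js c.1 : ℂ) * (ψ : FockN d N) (pairDown js c) = 0 := by
    by_cases h : hopDown N φ js c.1 = 0
    · simp [h]
    · rw [hψ, mul_zero]
      have := pairNum_pairDown_of_hopDown hjs h
      rintro (hs | hs) <;> rcases hc with hc | hc <;> omega
  rw [h1, h2, add_zero, add_zero]

/-- A shell never contains two neighbours of a chain, so the compression of `K` to it is diagonal
and is inverted entrywise. The bound `hC` places the range of `B` in the domain, which is defined by
the original diagonal energies rather than by `g`. -/
theorem IsTridiag.isReducedInverse (hK : IsTridiag N L φ js z t g K) (hjs : js ≠ 0) (htu : t ≤ u)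
    {B : FockN d N →L[ℂ] FockN d N} {C : ℝ} (hg : ∀ c, InShell N js u c → g c ≠ 0)
    (hC : ∀ c : Config d N, InShell N js u c → |(diagEnergy N L φ js c.1 - z) / g c| ≤ C)
    (hB : ∀ ψ c, B ψ c = (if InShell N js u c then ((g c)⁻¹ : ℂ) else 0) * ψ c) :
    IsReducedInverse (Q N js (2 * u)) K B := by
  have hQB : ∀ ψ, Q N js (2 * u) (B ψ) = B ψ := by
    intro ψ; ext c
    rw [Q_two_mul_apply, hB]
    split_ifs <;> simp
  have hBQ : ∀ ψ, B (Q N js (2 * u) ψ) = B ψ := by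
    intro ψ; ext c
    rw [hB, Q_two_mul_apply, hB]
    split_ifs <;> simp
  have hsupp : ∀ ψ c, ¬ InShell N js u c → B ψ c = 0 := by
    intro ψ c hc; rw [hB, if_neg hc, zero_mul]
  refine ⟨hQB, hBQ, fun ψ => ?_, fun ψ hψ => ?_⟩
  · have hd : B ψ ∈ K.domain := by
      rw [hK.mem_domain]
      have h1 : ∀ c : Config d N, ‖(if InShell N js u c then
          (((diagEnergy N L φ js c.1 - z) / g c : ℝ) : ℂ) else 0)‖ ≤ |C| := by
        intro c
        split_ifs with hc
        · rw [Complex.norm_real]; exact (hC c hc).trans (le_abs_self C)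
        · simp
      refine (memlp_mul h1 ψ).mono' fun c => ?_
      by_cases hc : InShell N js u c
      · rw [if_pos (hc.le htu), hB, if_pos hc, if_pos hc, ← mul_assoc]
        refine le_of_eq ?_
        push_cast
        rw [div_eq_mul_inv]
      · rw [hsupp ψ c hc]; simp
    refine ⟨hd, ?_⟩
    ext c
    rw [Q_two_mul_apply, Q_two_mul_apply]
    split_ifs with hc
    · rw [hK.apply_of_shell hjs ⟨B ψ, hd⟩ (hsupp ψ) htu hc]
      show (g c : ℂ) * B ψ c = ψ c
      have : (g c : ℂ) ≠ 0 := by exact_mod_cast hg c hc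
      rw [hB, if_pos hc, mul_inv_cancel_left₀ this]
    · rfl
  · ext c
    rw [hBQ, hB, Q_two_mul_apply]
    split_ifs with hc
    · have h2 : ∀ c, ¬ InShell N js u c → Q N js (2 * u) ψ c = 0 := by
        intro c hc; rw [Q_two_mul_apply, if_neg hc]
      rw [hK.apply_of_shell hjs ⟨_, hψ⟩ h2 htu hc]
      show ((g c)⁻¹ : ℂ) * (g c * Q N js (2 * u) ψ c) = ψ c
      have : (g c : ℂ) ≠ 0 := by exact_mod_cast hg c hc
      rw [Q_two_mul_apply, if_pos hc, inv_mul_cancel_left₀ this]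
    · simp

theorem exists_shellInverse (u : ℕ) {g : Config d N → ℝ} (hδ : 0 < δ)
    (hg : ∀ c, InShell N js u c → δ ≤ g c) : ∃ B : FockN d N →L[ℂ] FockN d N,
    ∀ ψ c, B ψ c = (if InShell N js u c then ((g c)⁻¹ : ℂ) else 0) * ψ c := by
  obtain ⟨B, -, hB⟩ := exists_diagonal (C := δ⁻¹)
    (g := fun c : Config d N => if InShell N js u c then ((g c)⁻¹ : ℂ) else 0) (by positivity) (by
      intro c
      have := inv_nonneg.mpr hδ.le
      split_ifs with hc
      · rw [norm_inv, Complex.norm_real, Real.norm_eq_abs]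
        exact inv_anti₀ hδ ((hg c hc).trans (le_abs_self _))
      · simpa using this)
  exact ⟨B, hB⟩

theorem InShell.one_le {c : Config d N} (h : InShell N js t c) (ht : t < N / 2) :
    1 ≤ pairNum js c.1 := by
  rcases h with h | h <;> omega

variable (h : PivotsBounded N L φ js z δ)
include h

theorem PivotsBounded.sectorPivot_le (hjs : js ≠ 0) (hφ : 0 < φ) (c : Config d N) :
    sectorPivot N L φ js z c.1 ≤ diagEnergy N L φ js c.1 - z := by
  have := h.gamEntry_nonneg hjs c
  rw [sectorPivot_eq_sub_gamEntry hjs hφ]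
  linarith

/-- `R_{2t,2t}(z)` is diagonal. -/
theorem PivotsBounded.isReducedInverse_hBogSub (hjs : js ≠ 0) (hφ : 0 < φ) (ht : t < N / 2) :
    ∃ B : FockN d N →L[ℂ] FockN d N,
      (∀ ψ c, B ψ c = (if InShell N js t c then
        (((diagEnergy N L φ js c.1 - z : ℝ) : ℂ)⁻¹) else 0) * ψ c) ∧
      IsReducedInverse (Q N js (2 * t)) (hBogSub N L φ js z) B := by
  have hD : ∀ c : Config d N, InShell N js t c → δ ≤ diagEnergy N L φ js c.1 - z := fun c hc =>
    (h.2 c (hc.one_le ht)).trans (h.sectorPivot_le hjs hφ c)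
  obtain ⟨B, hB⟩ := exists_shellInverse (js := js) t h.1 hD
  have hpos : ∀ c : Config d N, InShell N js t c → 0 < diagEnergy N L φ js c.1 - z := fun c hc =>
    h.1.trans_le (hD c hc)
  refine ⟨B, hB, (isTridiag_hBogSub hjs).isReducedInverse (C := 1) hjs (Nat.zero_le t)
    (fun c hc => (hpos c hc).ne') (fun c hc => ?_) hB⟩
  rw [div_self (hpos c hc).ne', abs_one]

/-- Diagonal entries of the Feshbach–Schur flow. -/
noncomputable def flowDiag (N : ℕ) (L φ : ℝ) (js : Mode d) (z : ℝ) (t : ℕ) (c : Config d N) : ℝ :=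
  if InShell N js t c then sectorPivot N L φ js z c.1 else diagEnergy N L φ js c.1 - z

theorem PivotsBounded.isReducedInverse_of_isTridiag (hjs : js ≠ 0) (hφ : 0 < φ) (ht : t < N / 2)
    (hK : IsTridiag N L φ js z t (flowDiag N L φ js z t) K) :
    ∃ B : FockN d N →L[ℂ] FockN d N,
      (∀ ψ c, B ψ c = (if InShell N js t c then
        ((sectorPivot N L φ js z c.1 : ℂ)⁻¹) else 0) * ψ c) ∧
      IsReducedInverse (Q N js (2 * t)) K B := by
  have hD : ∀ c : Config d N, InShell N js t c → δ ≤ flowDiag N L φ js z t c := fun c hc => by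
    rw [flowDiag, if_pos hc]; exact h.2 c (hc.one_le ht)
  obtain ⟨B, hB⟩ := exists_shellInverse (js := js) t h.1 hD
  have hδ := h.1
  refine ⟨B, fun ψ c => ?_, hK.isReducedInverse hjs le_rfl
    (fun c hc => (hδ.trans_le (hD c hc)).ne') (C := 1 +
      φ ^ 2 * ((N : ℝ) * N * (N + 1) * (N + 1) / N ^ 2) / δ / δ) (fun c hc => ?_) hB⟩
  · rw [hB]
    split_ifs with hc
    · rw [flowDiag, if_pos hc]
    · rfl
  · have h1 := hD c hc
    have h2 : 0 < flowDiag N L φ js z t c := hδ.trans_le h1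
    have h3 : diagEnergy N L φ js c.1 - z = flowDiag N L φ js z t c + gamEntry N L φ js z c := by
      rw [flowDiag, if_pos hc, sectorPivot_eq_sub_gamEntry hjs hφ]; ring
    have h4 := h.gamEntry_nonneg hjs c
    rw [h3, abs_of_nonneg (by positivity), add_div, div_self h2.ne']
    gcongr
    exact h.gamEntry_le hjs c

/-- Eliminating shell `t` affects only its neighbours in shell `t + 1`: there the diagonal entry
loses `w² / κ_up` and becomes the pivot. Each remaining configuration couples to at most one
eliminated one, so no new off-diagonal entries arise. -/
theorem PivotsBounded.isTridiag_feshbach (hjs : js ≠ 0) (hφ : 0 < φ) (ht : t < N / 2)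
    (hK : IsTridiag N L φ js z t (flowDiag N L φ js z t) K) :
    IsTridiag N L φ js z (t + 1) (flowDiag N L φ js z (t + 1))
      (feshbach (Qgt N js (2 * t)) (Q N js (2 * t)) K) := by
  obtain ⟨B, hB, hinv⟩ := h.isReducedInverse_of_isTridiag hjs hφ ht hK
  have hcond : ∀ c : Config d N, pairNum js c.1 + 2 * t + 1 < N ↔
      pairNum js c.1 + 2 * (t + 1) ≤ N := fun c => by omega
  have hle : ∀ c : Config d N, pairNum js c.1 + 2 * (t + 1) ≤ N → pairNum js c.1 + 2 * t ≤ N :=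
    fun c hc => by omega
  constructor
  · intro ψ
    show Qgt N js (2 * t) ψ ∈ K.domain ↔ _
    rw [hK.mem_domain]
    refine iff_of_eq (congrArg (Memℓp · 2) (funext fun c => ?_))
    rw [Qgt_apply]
    simp only [hcond]
    by_cases hc : pairNum js c.1 + 2 * (t + 1) ≤ N
    · rw [if_pos hc, if_pos hc, if_pos (hle c hc)]
    · simp [hc]
  · intro ψ c
    obtain ⟨χ, ξ, hξ, hχ, hξχ, hf⟩ := hinv.feshbach_apply (P := Qgt N js (2 * t)) ψ
    rw [hf, lp.coeFn_sub, Pi.sub_apply, Qgt_apply, Qgt_apply]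
    simp only [hcond]
    by_cases hc : pairNum js c.1 + 2 * (t + 1) ≤ N
    swap
    · simp [hc]
    have eχ := hK.apply_mk (χ := Qgt N js (2 * t) ψ) ψ.2
    rw [← hχ] at eχ
    rw [if_pos hc, if_pos hc, if_pos hc, hK.apply_mk, eχ, if_pos (hle c hc), if_pos (hle c hc)]
    have hns : ¬ InShell N js t c := by rintro (hs | hs) <;> omega
    have e0 : ∀ c', ξ c'
        = (if InShell N js t c' then ((sectorPivot N L φ js z c'.1 : ℂ)⁻¹) else 0) * χ c' := by
      intro c'
      rw [hξχ, hinv.2.1, hB]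
    simp only [e0, if_neg hns, zero_mul, mul_zero, zero_add]
    -- `pairDown` leads away from the eliminated shell, so the correction enters only through
    -- `pairUp`.
    have e1 : (hopDown N φ js c.1 : ℂ) * ((if InShell N js t (pairDown js c) then
        ((sectorPivot N L φ js z (pairDown js c).1 : ℂ)⁻¹) else 0) * χ (pairDown js c)) = 0 := by
      by_cases hd : hopDown N φ js c.1 = 0
      · simp [hd]
      · have := pairNum_pairDown_of_hopDown hjs hd
        have : ¬ InShell N js t (pairDown js c) := by rintro (hs | hs) <;> omega
        simp [this]
    rw [e1, add_zero]
    simp only [Qgt_apply, hcond, if_pos hc]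
    have e2 : (hopDown N φ js c.1 : ℂ) * (if pairNum js (pairDown js c).1 + 2 * (t + 1) ≤ N then
        (ψ : FockN d N) (pairDown js c) else 0)
        = hopDown N φ js c.1 * (ψ : FockN d N) (pairDown js c) := by
      by_cases hd : hopDown N φ js c.1 = 0
      · simp [hd]
      · have := pairNum_pairDown_of_hopDown hjs hd
        rw [if_pos (by omega)]
    have e3 : (if pairNum js (pairUp js c).1 + 2 * t ≤ N then
          (if pairNum js (pairUp js c).1 + 2 * (t + 1) ≤ N then
            (ψ : FockN d N) (pairUp js c) else 0) else 0)
        = if pairNum js (pairUp js c).1 + 2 * (t + 1) ≤ N then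
            (ψ : FockN d N) (pairUp js c) else 0 := by
      by_cases hu : pairNum js (pairUp js c).1 + 2 * (t + 1) ≤ N
      · rw [if_pos (hle _ hu)]
      · simp [hu]
    rw [e2, e3, flowDiag, if_neg hns]
    by_cases hh : hop N φ js c.1 = 0
    · have : sectorPivot N L φ js z c.1 = diagEnergy N L φ js c.1 - z := by
        rw [sectorPivot_eq hjs hφ, hh]; simp
      rw [flowDiag, this, ite_self, hh]
      simp
    · rw [flowDiag]
      have hiff := InShell.pairUp_iff (t := t) hjs hh
      -- On the eliminated shell, the image of the remaining components contains only the hop from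
      -- `c` itself: the diagonal part is cut off and the neighbour further up is already gone.
      have hχu : InShell N js t (pairUp js c) →
          χ (pairUp js c) = hop N φ js c.1 * (ψ : FockN d N) c := by
        intro hs
        have hns' : ¬ pairNum js (pairUp js c).1 + 2 * (t + 1) ≤ N := by
          rcases hs with hs | hs <;> omega
        rw [eχ, if_pos (hs.le le_rfl)]
        simp only [Qgt_apply, hcond]
        rw [pairDown_pairUp hjs (two_le_of_hop hh), if_neg hns', if_pos hc, hopDown_pairUp hjs hh]
        have : (hop N φ js (pairUp js c).1 : ℂ)
            * (if pairNum js (pairUp js (pairUp js c)).1 + 2 * t ≤ N then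
              (if pairNum js (pairUp js (pairUp js c)).1 + 2 * (t + 1) ≤ N then
              (ψ : FockN d N) (pairUp js (pairUp js c)) else 0) else 0) = 0 := by
          by_cases h3 : hop N φ js (pairUp js c).1 = 0
          · simp [h3]
          · rw [if_neg (hs.not_pairUp hjs h3), mul_zero]
        rw [this]
        ring
      by_cases hs : InShell N js t (pairUp js c)
      · rw [if_pos (hiff.mp hs), if_pos hs, if_pos (hs.le le_rfl), hχu hs, sectorPivot_eq hjs hφ c]
        push_cast
        ring
      · rw [if_neg (mt hiff.mpr hs), if_neg hs]
        simp

theorem PivotsBounded.isTridiag_flow (hjs : js ≠ 0) (hφ : 0 < φ) (t : ℕ) (ht : t ≤ N / 2) :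
    IsTridiag N L φ js z t (flowDiag N L φ js z t) (flow N L φ js z t) := by
  induction t with
  | zero =>
    have h0 : flowDiag (d := d) N L φ js z 0 = fun c => diagEnergy N L φ js c.1 - z := by
      funext c
      rw [flowDiag]
      split_ifs with hc
      -- In the top shell at most one particle is left for the zero mode, so nothing lies above and
      -- the pivot is the bare diagonal entry.
      · rw [sectorPivot_eq hjs hφ, hop_eq_zero, zero_pow two_ne_zero, zero_div, sub_zero]
        have := occ_add_pairNum_le hjs c
        rw [InShell, pairNum] at hc
        rcases hc with hc | hc <;> omega
      · rfl
    rw [h0]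
    exact isTridiag_hBogSub hjs
  | succ t ih => exact h.isTridiag_feshbach hjs hφ (by omega) (ih (by omega))

end Tridiagonal
-- The operators `Γ` and their Neumann series.
section Gamma

variable {d N : ℕ} {L φ z δ : ℝ} {js : Mode d} {t : ℕ} (h : PivotsBounded N L φ js z δ)
include h

/-- `R_{2t,2t}(z)` is diagonal. -/
theorem PivotsBounded.R_apply (hjs : js ≠ 0) (hφ : 0 < φ) (ht : t < N / 2) (ψ : FockN d N)
    (c : Config d N) : R N L φ js z (2 * t) ψ c = (if InShell N js t c then
        (((diagEnergy N L φ js c.1 - z : ℝ) : ℂ)⁻¹) else 0) * ψ c := by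
  obtain ⟨B, hB, hinv⟩ := h.isReducedInverse_hBogSub hjs hφ ht
  rw [R, hinv.reducedInverse_eq, hB]

/-- If `Γ_{2t,2t}(z)` is diagonal, the Neumann series converges and can be summed. -/
theorem PivotsBounded.neumann (hjs : js ≠ 0) (hφ : 0 < φ) (ht : t < N / 2)
    (hG : ∀ ψ (c : Config d N), Gam N L φ js z t ψ c
      = (if InShell N js t c then (gamEntry N L φ js z c : ℂ) else 0) * ψ c) :
    (Summable fun l : ℕ => (Gam N L φ js z t * R N L φ js z (2 * t)) ^ l) ∧
    ∀ ψ (c : Config d N), InShell N js t c →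
      R N L φ js z (2 * t) ((∑' l : ℕ, (Gam N L φ js z t * R N L φ js z (2 * t)) ^ l) ψ) c
        = ((sectorPivot N L φ js z c.1 : ℂ)⁻¹) * ψ c := by
  set A := Gam N L φ js z t * R N L φ js z (2 * t) with hA
  set b := φ ^ 2 * ((N : ℝ) * N * (N + 1) * (N + 1) / N ^ 2) / δ with hb
  have hδ := h.1
  have hb0 : 0 ≤ b := by positivity
  have hρ : 0 ≤ b / (b + δ) := by positivity
  have hAa : ∀ ψ (c : Config d N), A ψ c = (if InShell N js t c then
      ((gamEntry N L φ js z c / (diagEnergy N L φ js c.1 - z) : ℝ) : ℂ) else 0) * ψ c := by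
    intro ψ c
    show Gam N L φ js z t (R N L φ js z (2 * t) ψ) c = _
    rw [hG, h.R_apply hjs hφ ht]
    split_ifs
    · push_cast; ring
    · simp
  have hpos : ∀ c : Config d N, InShell N js t c → δ ≤ sectorPivot N L φ js z c.1 :=
    fun c hc => h.2 c (hc.one_le ht)
  have hD : ∀ c : Config d N, diagEnergy N L φ js c.1 - z
      = gamEntry N L φ js z c + sectorPivot N L φ js z c.1 := fun c => by
    rw [sectorPivot_eq_sub_gamEntry hjs hφ]; ring
  -- The entries of `Γ R` are `γ / (γ + κ)` with `0 ≤ γ ≤ b` and `κ ≥ δ`, hence at most `b / (b + δ)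
  -- < 1`.
  obtain ⟨A', hn, hA'⟩ := exists_diagonal (C := b / (b + δ)) (g := fun c : Config d N =>
    if InShell N js t c then
      ((gamEntry N L φ js z c / (diagEnergy N L φ js c.1 - z) : ℝ) : ℂ) else 0) hρ (by
    intro c
    split_ifs with hc
    · have h1 := h.gamEntry_nonneg hjs c
      have h2 := h.gamEntry_le hjs c
      have h3 := hpos c hc
      rw [Complex.norm_real, hD, Real.norm_eq_abs, abs_of_nonneg (by
        have : 0 < sectorPivot N L φ js z c.1 := by linarith
        positivity), div_le_div_iff₀ (by linarith) (by linarith)]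
      have h4 : gamEntry N L φ js z c ≤ b := h2
      have h5 : gamEntry N L φ js z c * δ ≤ b * sectorPivot N L φ js z c.1 :=
        mul_le_mul h4 h3 hδ.le hb0
      linarith
    · simpa using hρ)
  have hAA : A = A' := by
    ext ψ c
    rw [hAa, hA']
  have hlt : ‖A‖ < 1 := by
    rw [hAA]
    refine hn.trans_lt ?_
    rw [div_lt_one (by linarith)]
    linarith
  refine ⟨summable_geometric_of_norm_lt_one hlt, fun ψ c hc => ?_⟩
  -- The sum is used only through `(1 - A) S = 1`, which at `c` reads `(1 - γ / D) (S ψ) c = ψ c`;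
  -- applying `R` then gives `ψ c / (D - γ)`.
  have hs := mul_neg_geom_series A hlt
  set S := ∑' l : ℕ, A ^ l with hS
  have h1 : (S ψ) c - A (S ψ) c = ψ c := by
    have := congrArg (fun T : FockN d N →L[ℂ] FockN d N => T ψ c) hs
    exact this
  rw [hAa, if_pos hc] at h1
  rw [h.R_apply hjs hφ ht, if_pos hc, ← h1]
  have h3 := hpos c hc
  have hp : (sectorPivot N L φ js z c.1 : ℂ) ≠ 0 := by
    exact_mod_cast (hδ.trans_le h3).ne'
  have hd : ((diagEnergy N L φ js c.1 - z : ℝ) : ℂ) ≠ 0 := by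
    have := h.gamEntry_nonneg hjs c
    have h4 := hD c
    have : 0 < diagEnergy N L φ js c.1 - z := by linarith
    exact_mod_cast this.ne'
  have h5 : (sectorPivot N L φ js z c.1 : ℂ)
      = ((diagEnergy N L φ js c.1 - z : ℝ) : ℂ) - gamEntry N L φ js z c := by
    rw [hD]; push_cast; ring
  rw [Complex.ofReal_div]
  generalize ((diagEnergy N L φ js c.1 - z : ℝ) : ℂ) = D at *
  field_simp
  rw [h5]

/-- `Γ` is a round trip: `W^*` up the chain, multiplication by `1 / κ_up`, then `W` back down. It
returns to the starting configuration with weight `w² / κ_up`. -/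
theorem PivotsBounded.Gam_apply (hjs : js ≠ 0) (hφ : 0 < φ) (t : ℕ) (ht : t < N / 2)
    (ψ : FockN d N) (c : Config d N) : Gam N L φ js z t ψ c
      = (if InShell N js t c then (gamEntry N L φ js z c : ℂ) else 0) * ψ c := by
  induction t generalizing ψ c with
  | zero =>
    have : (if InShell N js 0 c then (gamEntry N L φ js z c : ℂ) else 0) = 0 := by
      split_ifs with hc
      · rw [gamEntry, hop_eq_zero]
        · simp
        · have := occ_add_pairNum_le hjs c
          rw [InShell, pairNum] at hc
          rcases hc with hc | hc <;> omega
      · rfl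
    rw [this, zero_mul]
    rfl
  | succ t ih =>
    obtain ⟨-, hS⟩ := h.neumann hjs hφ (by omega) (ih (by omega))
    set S := ∑' l : ℕ, (Gam N L φ js z t * R N L φ js z (2 * t)) ^ l with hSdef
    have h1 : Gam N L φ js z (t + 1) ψ c = Q N js (2 * (t + 1)) (W N φ js (Q N js (2 * t)
        (R N L φ js z (2 * t) (S (Q N js (2 * t) (Wst N φ js
          (Q N js (2 * (t + 1)) ψ))))))) c := rfl
    rw [h1, Q_two_mul_apply]
    split_ifs with hc
    · rw [W_apply hjs, gamEntry]
      by_cases hh : hop N φ js c.1 = 0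
      · simp [hh]
      · have hs := (InShell.pairUp_iff (t := t) hjs hh).mpr hc
        rw [Q_two_mul_apply, if_pos hs, hS _ _ hs, Q_two_mul_apply, if_pos hs, Wst_apply hjs,
          pairDown_pairUp hjs (two_le_of_hop hh), Q_two_mul_apply, if_pos hc,
          hopDown_pairUp hjs hh]
        push_cast
        ring
    · simp

theorem PivotsBounded.flowWellDefined (hjs : js ≠ 0) (hφ : 0 < φ) :
    FlowWellDefined N L φ js z := by
  intro t ht
  obtain ⟨B, -, hB⟩ := h.isReducedInverse_of_isTridiag hjs hφ ht
    (h.isTridiag_flow hjs hφ t ht.le)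
  obtain ⟨B', -, hB'⟩ := h.isReducedInverse_hBogSub hjs hφ ht
  exact ⟨⟨B, hB⟩, ⟨B', hB'⟩, (h.neumann hjs hφ ht (h.Gam_apply hjs hφ t ht)).1⟩

end Gamma

/-! ### The state `η` and the last Feshbach–Schur step. -/

section Eta

variable {d N : ℕ} {L φ z δ : ℝ} {js : Mode d}

/-- The configuration with all particles in the zero mode. -/
noncomputable def etaConfig (d N : ℕ) : Config d N := ⟨Finsupp.single 0 N, by simp⟩

theorem eta_apply_self : eta d N (etaConfig d N) = 1 := lp.single_apply_self 2 _ _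

theorem eta_apply_of_ne {c : Config d N} (hc : c ≠ etaConfig d N) : eta d N c = 0 :=
  lp.single_apply_ne 2 _ _ hc

theorem inner_eta (ψ : FockN d N) : ⟪eta d N, ψ⟫_ℂ = ψ (etaConfig d N) := by
  refine (lp.inner_single_left _ _ _).trans ?_
  simp
  rfl

theorem Peta_apply_self (ψ : FockN d N) :
    Peta d N ψ (etaConfig d N) = ψ (etaConfig d N) := by
  rw [Peta, InnerProductSpace.rankOne_apply, inner_eta, lp.coeFn_smul, Pi.smul_apply,
    eta_apply_self, smul_eq_mul, mul_one]

theorem Peta_apply_of_ne (ψ : FockN d N) {c : Config d N} (hc : c ≠ etaConfig d N) :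
    Peta d N ψ c = 0 := by
  rw [Peta, InnerProductSpace.rankOne_apply, lp.coeFn_smul, Pi.smul_apply,
    eta_apply_of_ne hc, smul_zero]

theorem etaConfig_zero : (etaConfig d N).1 0 = N := by simp [etaConfig]

theorem etaConfig_of_ne {j : Mode d} (hj : j ≠ 0) : (etaConfig d N).1 j = 0 := by
  simp [etaConfig, hj.symm]

theorem pairNum_etaConfig (hjs : js ≠ 0) : pairNum js (etaConfig d N).1 = 0 := by
  rw [pairNum, etaConfig_of_ne hjs, etaConfig_of_ne (mode_neg_ne_zero hjs)]

theorem restEnergy_etaConfig : restEnergy L js (etaConfig d N).1 = 0 := by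
  refine Finset.sum_eq_zero fun j _ => ?_
  by_cases hj : j = 0
  · rw [hj, kSq_zero, zero_mul]
  · rw [etaConfig_of_ne hj]; simp

theorem diagEnergy_etaConfig (hjs : js ≠ 0) : diagEnergy N L φ js (etaConfig d N).1 = 0 := by
  rw [diagEnergy, restEnergy_etaConfig, etaConfig_of_ne hjs, etaConfig_of_ne (mode_neg_ne_zero hjs)]
  simp

theorem PetaBar_apply (hjs : js ≠ 0) (hN : 2 ≤ N) (ψ : FockN d N) (c : Config d N) [Decidable
    (pairNum js c.1 = 0 ∧ c ≠ etaConfig d N)] : PetaBar N js ψ c =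
    if pairNum js c.1 = 0 ∧ c ≠ etaConfig d N then ψ c else 0 := by
  rw [PetaBar, sub_apply, lp.coeFn_sub, Pi.sub_apply, Qgt_apply]
  by_cases hc : c = etaConfig d N
  · have h1 := pairNum_etaConfig (N := N) hjs
    subst hc
    rw [Peta_apply_self, if_pos (by omega), if_neg (by simp), sub_self]
  · rw [Peta_apply_of_ne _ hc, sub_zero]
    by_cases hp : pairNum js c.1 = 0
    · rw [if_pos (by omega), if_pos ⟨hp, hc⟩]
    · rw [if_neg (by omega), if_neg (fun hh => hp hh.1)]

/-- The inner product is `w² / κ_up` at `η`, whose diagonal energy is zero. Evenness of `N` puts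
`pairUp js η`, with pair number two, in the last eliminated shell. -/
theorem PivotsBounded.fFun_eq (h : PivotsBounded N L φ js z δ) (hjs : js ≠ 0) (hφ : 0 < φ)
    (hN : 2 ≤ N) (hev : Even N) : fFun N L φ js z = sectorPivot N L φ js z (etaConfig d N).1 := by
  obtain ⟨m, hm⟩ := hev
  have ht : N / 2 - 1 < N / 2 := by omega
  have h2 : N - 2 = 2 * (N / 2 - 1) := by omega
  obtain ⟨-, hS⟩ := h.neumann hjs hφ ht (h.Gam_apply hjs hφ _ ht)
  have h0 : 2 ≤ (etaConfig d N).1 0 := by rw [etaConfig_zero]; exact hN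
  have hs : InShell N js (N / 2 - 1) (pairUp js (etaConfig d N)) := by
    left
    rw [pairNum_pairUp hjs h0, pairNum_etaConfig hjs]
    omega
  rw [fFun, h2, inner_eta, W_apply hjs, hS _ _ hs, Wst_apply hjs, pairDown_pairUp hjs h0,
    eta_apply_self, sectorPivot_eq hjs hφ (etaConfig d N), diagEnergy_etaConfig hjs, pairUp_val h0,
    hopDown_pairUpOcc hjs h0]
  push_cast
  ring

/-- `𝒦^{Bog (N-2)}(z)` is diagonal. -/
theorem PivotsBounded.KNm2_apply (h : PivotsBounded N L φ js z δ) (hjs : js ≠ 0) (hφ : 0 < φ)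
    (hev : Even N) {χ : FockN d N} (hχ : χ ∈ (KNm2 N L φ js z).domain) (c : Config d N) :
    (KNm2 N L φ js z ⟨χ, hχ⟩ : FockN d N) c =
      if pairNum js c.1 = 0 then sectorPivot N L φ js z c.1 * χ c else 0 := by
  obtain ⟨m, hm⟩ := hev
  have hK := h.isTridiag_flow hjs hφ (N / 2) le_rfl
  have e1 : ∀ c : Config d N, pairNum js c.1 + 2 * (N / 2) ≤ N ↔ pairNum js c.1 = 0 := by
    intro c; omega
  refine (hK.apply_mk hχ c).trans ?_
  simp only [e1]
  by_cases hc : pairNum js c.1 = 0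
  · rw [if_pos hc, if_pos hc, flowDiag, if_pos (show InShell N js (N / 2) c from Or.inl (by omega))]
    have h1 : hopDown N φ js c.1 = 0 := by
      by_contra hh
      have := pairNum_pairDown_of_hopDown hjs hh
      omega
    have h2 : (hop N φ js c.1 : ℂ)
        * (if pairNum js (pairUp js c).1 = 0 then χ (pairUp js c) else 0) = 0 := by
      by_cases hh : hop N φ js c.1 = 0
      · simp [hh]
      · rw [if_neg, mul_zero]
        rw [pairNum_pairUp hjs (two_le_of_hop hh)]
        omega
    rw [h2, h1]
    simp
  · rw [if_neg hc, if_neg hc]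

theorem PivotsBounded.mem_KNm2_domain (h : PivotsBounded N L φ js z δ) (hjs : js ≠ 0)
    (hφ : 0 < φ) (hev : Even N) {χ : FockN d N} :
    χ ∈ (KNm2 N L φ js z).domain ↔ Memℓp (fun c : Config d N => if pairNum js c.1 = 0 then
      ((diagEnergy N L φ js c.1 - z : ℝ) : ℂ) * χ c else 0) 2 := by
  obtain ⟨m, hm⟩ := hev
  have hK := h.isTridiag_flow hjs hφ (N / 2) le_rfl
  have e1 : ∀ c : Config d N, pairNum js c.1 + 2 * (N / 2) ≤ N ↔ pairNum js c.1 = 0 := by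
    intro c; omega
  refine (hK.mem_domain χ).trans ?_
  simp only [e1]

-- Only configurations without particles in `± j⋆` survive, and distinct ones lie on distinct
-- chains. Thus `𝒦^{(N-2)}` is diagonal, and a positive lower bound on its entries away from `η`
-- makes it invertible there.
open Classical in
theorem PivotsBounded.isReducedInverse_PetaBar (h : PivotsBounded N L φ js z δ) (hjs : js ≠ 0)
    (hφ : 0 < φ) (hN : 2 ≤ N) (hev : Even N) {δ' : ℝ} (hδ' : 0 < δ')
    (hp : ∀ c : Config d N, pairNum js c.1 = 0 → c ≠ etaConfig d N →
      δ' ≤ sectorPivot N L φ js z c.1) :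
    ∃ B : FockN d N →L[ℂ] FockN d N,
      (∀ ψ c, B ψ c = (if pairNum js c.1 = 0 ∧ c ≠ etaConfig d N then
        ((sectorPivot N L φ js z c.1 : ℂ)⁻¹) else 0) * ψ c) ∧
      IsReducedInverse (PetaBar N js) (KNm2 N L φ js z) B := by
  obtain ⟨B, -, hB⟩ := exists_diagonal (C := δ'⁻¹)
    (g := fun c : Config d N => if pairNum js c.1 = 0 ∧ c ≠ etaConfig d N then
      ((sectorPivot N L φ js z c.1 : ℂ)⁻¹) else 0) (by positivity) (by
      intro c
      have := inv_nonneg.mpr hδ'.le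
      split_ifs with hc
      · rw [norm_inv, Complex.norm_real, Real.norm_eq_abs]
        exact inv_anti₀ hδ' ((hp c hc.1 hc.2).trans (le_abs_self _))
      · simpa using this)
  have hne : ∀ c : Config d N, pairNum js c.1 = 0 ∧ c ≠ etaConfig d N →
      (sectorPivot N L φ js z c.1 : ℂ) ≠ 0 := fun c hc => by
    exact_mod_cast (hδ'.trans_le (hp c hc.1 hc.2)).ne'
  refine ⟨B, hB, fun ψ => ?_, fun ψ => ?_, fun ψ => ?_, fun ψ hψ => ?_⟩
  · ext c
    rw [PetaBar_apply hjs hN, hB]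
    split_ifs <;> simp
  · ext c
    rw [hB, PetaBar_apply hjs hN, hB]
    split_ifs <;> simp
  · have hd : B ψ ∈ (KNm2 N L φ js z).domain := by
      rw [h.mem_KNm2_domain hjs hφ hev]
      set b := φ ^ 2 * ((N : ℝ) * N * (N + 1) * (N + 1) / N ^ 2) / δ with hb
      have hδ := h.1
      have h1 : ∀ c : Config d N, ‖(if pairNum js c.1 = 0 ∧ c ≠ etaConfig d N then
          (((diagEnergy N L φ js c.1 - z) / sectorPivot N L φ js z c.1 : ℝ) : ℂ) else 0)‖
          ≤ 1 + b / δ' := by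
        intro c
        split_ifs with hc
        · have h2 := hp c hc.1 hc.2
          have h3 : 0 < sectorPivot N L φ js z c.1 := hδ'.trans_le h2
          have h4 : diagEnergy N L φ js c.1 - z
              = sectorPivot N L φ js z c.1 + gamEntry N L φ js z c := by
            rw [sectorPivot_eq_sub_gamEntry hjs hφ]; ring
          have h5 := h.gamEntry_nonneg hjs c
          rw [Complex.norm_real, Real.norm_eq_abs, h4, abs_of_nonneg (by positivity), add_div,
            div_self h3.ne']
          have h6 := h.gamEntry_le hjs c
          gcongr
        · rw [norm_zero]; positivity
      refine (memlp_mul h1 ψ).mono' fun c => ?_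
      by_cases hc : pairNum js c.1 = 0 ∧ c ≠ etaConfig d N
      · rw [if_pos hc.1, hB, if_pos hc, if_pos hc, ← mul_assoc]
        refine le_of_eq ?_
        push_cast
        rw [div_eq_mul_inv]
      · rw [hB, if_neg hc]; simp
    refine ⟨hd, ?_⟩
    ext c
    rw [PetaBar_apply hjs hN, PetaBar_apply hjs hN, h.KNm2_apply hjs hφ hev]
    split_ifs with hc h0
    · rw [hB, if_pos hc, mul_inv_cancel_left₀ (hne c hc)]
    · exact absurd hc.1 h0
    · rfl
  · ext c
    rw [hB, PetaBar_apply hjs hN, PetaBar_apply hjs hN, h.KNm2_apply hjs hφ hev,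
      PetaBar_apply hjs hN]
    split_ifs with hc h0
    · rw [inv_mul_cancel_left₀ (hne c hc)]
    · exact absurd hc.1 h0
    · rw [zero_mul]

/-- A diagonal operator does not couple `η` to its complement, so the Feshbach correction vanishes.
The domain is the whole space because `𝒫_η ψ` lives on a single configuration. -/
theorem PivotsBounded.KN_eq (h : PivotsBounded N L φ js z δ) (hjs : js ≠ 0)
    (hφ : 0 < φ) (hN : 2 ≤ N) (hev : Even N) {δ' : ℝ} (hδ' : 0 < δ')
    (hp : ∀ c : Config d N, pairNum js c.1 = 0 → c ≠ etaConfig d N →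
      δ' ≤ sectorPivot N L φ js z c.1) :
    KN N L φ js z = LinearMap.toPMap
      ((fFun N L φ js z • Peta d N : FockN d N →L[ℂ] FockN d N) :
        FockN d N →ₗ[ℂ] FockN d N) ⊤ := by
  classical
  obtain ⟨B, hB, hinv⟩ := h.isReducedInverse_PetaBar hjs hφ hN hev hδ' hp
  refine LinearPMap.ext ?_ ?_
  · ext ψ
    refine iff_of_true ?_ Submodule.mem_top
    show Peta d N ψ ∈ (KNm2 N L φ js z).domain
    rw [h.mem_KNm2_domain hjs hφ hev]
    have h1 : ∀ c : Config d N, ‖(if c = etaConfig d N then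
        ((diagEnergy N L φ js c.1 - z : ℝ) : ℂ) else 0)‖
        ≤ |diagEnergy N L φ js (etaConfig d N).1 - z| := by
      intro c
      split_ifs with hc
      · rw [Complex.norm_real, hc, Real.norm_eq_abs]
      · simp
    refine (memlp_mul h1 ψ).mono' fun c => ?_
    by_cases hc : c = etaConfig d N
    · subst hc
      rw [if_pos (pairNum_etaConfig hjs), Peta_apply_self, if_pos rfl]
    · rw [Peta_apply_of_ne _ hc]; simp
  · intro ψ h1 h2
    obtain ⟨χ, ξ, hξ, hχ, hξχ, hf⟩ := hinv.feshbach_apply (P := Peta d N) ⟨ψ, h1⟩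
    refine Eq.trans hf ?_
    ext c
    rw [lp.coeFn_sub, Pi.sub_apply]
    show _ = (fFun N L φ js z • Peta d N ψ) c
    rw [lp.coeFn_smul, Pi.smul_apply]
    by_cases hc : c = etaConfig d N
    · subst hc
      have eχ := h.KNm2_apply hjs hφ hev (χ := Peta d N ψ) h1 (etaConfig d N)
      rw [if_pos (pairNum_etaConfig hjs), Peta_apply_self] at eχ
      rw [Peta_apply_self, Peta_apply_self, Peta_apply_self, h.KNm2_apply hjs hφ hev,
        if_pos (pairNum_etaConfig hjs), hξχ, hB, h.fFun_eq hjs hφ hN hev,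
        (congrArg (fun η : FockN d N => η (etaConfig d N)) hχ).trans eχ]
      simp
    · simp [Peta_apply_of_ne _ hc]

end Eta
-- The spectral gap.
section Gap

variable {d : ℕ} {L : ℝ}

theorem le_kSq {j : Mode d} (hj : j ≠ 0) : (2 * Real.pi / L) ^ 2 ≤ kSq L j := by
  obtain ⟨i, hi⟩ : ∃ i, j i ≠ 0 := Function.ne_iff.mp hj
  have h1 : (1 : ℝ) ≤ (j i : ℝ) ^ 2 := by
    have : 1 ≤ (j i) ^ 2 := by
      have := sq_nonneg (j i)
      have : (j i) ^ 2 ≠ 0 := pow_ne_zero 2 hi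
      omega
    exact_mod_cast this
  refine le_trans ?_ (Finset.single_le_sum (f := fun i => (2 * Real.pi / L * (j i : ℝ)) ^ 2)
    (fun _ _ => sq_nonneg _) (Finset.mem_univ i))
  show _ ≤ (2 * Real.pi / L * (j i : ℝ)) ^ 2
  rw [mul_pow]
  exact le_mul_of_one_le_right (sq_nonneg _) h1

theorem kSq_pos (hL : 0 < L) {j : Mode d} (hj : j ≠ 0) : 0 < kSq L j := by
  have := Real.pi_pos
  exact lt_of_lt_of_le (by positivity) (le_kSq hj)

theorem gap_le {j : Mode d} (hj : j ≠ 0) : gap d L ≤ kSq L j :=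
  ciInf_le ⟨0, by rintro _ ⟨j, rfl⟩; exact kSq_nonneg _⟩ (⟨j, hj⟩ : {j : Mode d // j ≠ 0})

theorem gap_pos (hL : 0 < L) {j : Mode d} (hj : j ≠ 0) : 0 < gap d L := by
  have := Real.pi_pos
  have : Nonempty {j : Mode d // j ≠ 0} := ⟨⟨j, hj⟩⟩
  exact lt_of_lt_of_le (b := (2 * Real.pi / L) ^ 2) (by positivity)
    (le_ciInf fun j => le_kSq j.2)

/-- Excitations outside the modes `± js` cost at least the spectral gap. -/
theorem gap_le_restEnergy {N : ℕ} {js : Mode d} {c : Config d N} (h0 : pairNum js c.1 = 0)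
    (hc : c ≠ etaConfig d N) : gap d L ≤ restEnergy L js c.1 := by
  obtain ⟨j, hj, hjc⟩ : ∃ j, j ≠ 0 ∧ c.1 j ≠ 0 := by
    by_contra hall
    push Not at hall
    have h1 : c.1 = Finsupp.single 0 (c.1 0) := by
      ext j
      by_cases hj : j = 0
      · simp [hj]
      · rw [hall j hj, Finsupp.single_apply, if_neg (Ne.symm hj)]
    have h2 := c.2
    rw [h1, Finsupp.sum_single_index rfl] at h2
    exact hc (Subtype.ext (by rw [h1, h2]; rfl))
  rw [pairNum] at h0
  have hjs1 : j ≠ js := fun hh => hjc (by rw [hh]; omega)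
  have hjs2 : j ≠ -js := fun hh => hjc (by rw [hh]; omega)
  have h1 : (1 : ℝ) ≤ c.1 j := by exact_mod_cast Nat.one_le_iff_ne_zero.mpr hjc
  calc gap d L ≤ kSq L j := gap_le hj
    _ ≤ kSq L j * c.1 j := le_mul_of_one_le_right (kSq_nonneg j) h1
    _ ≤ restEnergy L js c.1 := Finset.single_le_sum
        (f := fun j => kSq L j * (c.1 j : ℝ))
        (fun j _ => mul_nonneg (kSq_nonneg j) (Nat.cast_nonneg _))
        (Finset.mem_filter.mpr ⟨Finsupp.mem_support_iff.mpr hjc, hjs1, hjs2⟩)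

end Gap

/-! ### The threshold `z_max` in units of `φ`. -/

section Threshold

variable {d N : ℕ} {L φ z e s x : ℝ} {js : Mode d}

theorem bogParam_of_eps {ε : ℝ} (h0 : 0 < ε) (h1 : ε ≤ 1 / 100) :
    BogParam (√ε) (√(ε ^ 2 + 2 * ε)) (1 + ε - √(ε ^ 2 + 2 * ε)) where
  e_pos := Real.sqrt_pos.mpr h0
  e_le := Real.sqrt_le_iff.mpr ⟨by norm_num, by norm_num; linarith⟩
  s_pos := Real.sqrt_pos.mpr (by positivity)
  s_sq := by
    have : √ε ^ 4 = ε ^ 2 := by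
      rw [show √ε ^ 4 = (√ε ^ 2) ^ 2 by ring, Real.sq_sqrt h0.le]
    rw [Real.sq_sqrt (by positivity), Real.sq_sqrt h0.le, this]
  x_eq := by rw [Real.sq_sqrt h0.le]

/-- In units of `φ` the Bogoliubov energy is `-x` and the margin above it is `e s`. -/
theorem zMax_eq (hφ : 0 < φ) : zMax L φ js =
    -(φ * ((1 + eps L φ js - √(eps L φ js ^ 2 + 2 * eps L φ js))
      - √(eps L φ js) * √(eps L φ js ^ 2 + 2 * eps L φ js))) := by
  have h1 : kSq L js = φ * eps L φ js := by rw [eps]; field_simp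
  have h2 : √(kSq L js ^ 2 + 2 * φ * kSq L js)
      = φ * √(eps L φ js ^ 2 + 2 * eps L φ js) := by
    rw [h1, show (φ * eps L φ js) ^ 2 + 2 * φ * (φ * eps L φ js)
      = φ ^ 2 * (eps L φ js ^ 2 + 2 * eps L φ js) by ring, Real.sqrt_mul (by positivity),
      Real.sqrt_sq hφ.le]
  rw [zMax, eBog, h2, h1]
  ring

theorem threshold_le_shift (hz : z ≤ -(φ * (x - e * s))) (hφ : 0 < φ) (n : Occ d) :
    x - e * s ≤ (restEnergy L js n - z) / φ := by
  have := restEnergy_nonneg (L := L) (js := js) n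
  rw [le_div_iff₀ hφ]
  linarith

theorem BogParam.pivotsBounded (h : BogParam e s x) (he : eps L φ js = e ^ 2)
    (hz : z ≤ -(φ * (x - e * s))) (hjs : js ≠ 0) (hφ : 0 < φ) (hN : 0 < N) :
    PivotsBounded N L φ js z (φ * (1 / N * (2 / 5))) := by
  have hN0 : (0 : ℝ) < N := by exact_mod_cast hN
  refine ⟨by positivity, fun c hc => ?_⟩
  have h1 := occ_add_pairNum_le hjs c
  have h2 : (c.1 0 : ℝ) + c.1 js + c.1 (-js) ≤ N := by
    exact_mod_cast (by omega : c.1 0 + c.1 js + c.1 (-js) ≤ N)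
  have hv := threshold_le_shift (L := L) (js := js) hz hφ c.1
  have h3 := h.pivot_pos hN0 hv (by rw [pairNum] at hc; omega) h2
  rw [sectorPivot, he]
  refine mul_le_mul_of_nonneg_left ?_ hφ.le
  linarith

end Threshold

end BogThreeModes

/-! ### Proof of the lemma. -/

open BogThreeModes
theorem mainTheorem7 :
    ∀ γ : ℝ, 0 < γ → γ < 1 → ∃ kγ : ℝ, 0 < kγ ∧
    ∀ μ θ C : ℝ, 0 < μ → μ < 1 → 0 < θ → 0 < C → ∃ ε₀ : ℝ, 0 < ε₀ ∧
    ∀ (d N : ℕ) (L φ : ℝ) (js : Mode d),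
      1 ≤ d → 0 < N → Even N → 0 < L → 0 < φ → js ≠ 0 →
      eps L φ js ≤ ε₀ →
      (eps L φ js) ^ 2 + eps L φ js / (N : ℝ) ^ γ + 1 / (N : ℝ)
        ≤ kγ * eps L φ js * Real.sqrt (eps L φ js) →
      1 / (N : ℝ) ^ (1 - γ) ≤ kγ * eps L φ js →
      φ / gap d L * ((N : ℝ) ^ μ / ((N : ℝ) * ((N : ℝ) - (N : ℝ) ^ μ))) < 1 / 2 →
      1 / (N : ℝ) ^ μ ≤ C * Real.sqrt (eps L φ js) ^ (1 + θ) →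
      (∀ z : ℝ, z ≤ zMax L φ js → FlowWellDefined N L φ js z) ∧
      ∃ zs : ℝ,
        (zs ≤ zMax L φ js ∧ fFun N L φ js zs = 0 ∧
          ∀ z : ℝ, z ≤ zMax L φ js → fFun N L φ js z = 0 → z = zs) ∧
        zs < min (zs + gap d L / 2) (zMax L φ js) ∧
        ∀ z : ℝ, z < min (zs + gap d L / 2) (zMax L φ js) →
          BoundedInvertibleOn (PetaBar N js) (KNm2 N L φ js z) ∧
          KN N L φ js z = LinearMap.toPMap
            ((fFun N L φ js z • Peta d N : FockN d N →L[ℂ] FockN d N) :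
              FockN d N →ₗ[ℂ] FockN d N) ⊤ := by
  intro γ hγ hγ1
  -- `kγ = 1 / 100` turns the first assumption into `N e³ ≥ 100`, and `ε₀ = 1 / 100` gives `e ≤ 1 /
  -- 10`.
  refine ⟨1 / 100, by norm_num, fun μ θ C hμ hμ1 hθ hC => ⟨1 / 100, by norm_num, ?_⟩⟩
  intro d N L φ js hd hN hev hL hφ hjs hε hcond _ _ _
  have hN0 : (0 : ℝ) < N := by exact_mod_cast hN
  have hN2 : 2 ≤ N := by obtain ⟨m, hm⟩ := hev; omega
  have hε0 : 0 < eps L φ js := div_pos (kSq_pos hL hjs) hφ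
  have hp := bogParam_of_eps hε0 hε
  rw [zMax_eq hφ]
  have he : eps L φ js = √(eps L φ js) ^ 2 := (Real.sq_sqrt hε0.le).symm
  have hNe3 : 100 ≤ N * √(eps L φ js) ^ 3 := by
    have h1 : 0 ≤ (eps L φ js) ^ 2 + eps L φ js / (N : ℝ) ^ γ := by positivity
    have h2 : 1 / (N : ℝ) ≤ 1 / 100 * eps L φ js * √(eps L φ js) := by linarith
    have h3 : eps L φ js * √(eps L φ js) = √(eps L φ js) ^ 3 := by
      conv_lhs => rw [he]
      rw [Real.sqrt_sq (Real.sqrt_nonneg _)]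
      ring
    rw [mul_assoc, h3, div_le_iff₀ hN0] at h2
    linarith
  generalize √(eps L φ js) = e at *
  generalize √(eps L φ js ^ 2 + 2 * eps L φ js) = s at *
  generalize 1 + eps L φ js - s = x at *
  have he0 := hp.e_pos
  have hNe : 5 ≤ N * e := by
    have h1 : e ^ 2 ≤ 1 / 100 := by linarith
    have h2 : N * e * e ^ 2 ≤ N * e * (1 / 100) := by gcongr
    nlinarith
  have hb : ∀ z, z ≤ -(φ * (x - e * s)) → PivotsBounded N L φ js z (φ * (1 / N * (2 / 5))) :=
    fun z hz => hp.pivotsBounded he hz hjs hφ hN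
  have hf : ∀ z, z ≤ -(φ * (x - e * s)) →
      fFun N L φ js z = ((φ * pivot N (e ^ 2) (-z / φ) N 0 0 : ℝ) : ℂ) := fun z hz => by
    rw [(hb z hz).fFun_eq hjs hφ hN2 hev, sectorPivot, he, restEnergy_etaConfig, etaConfig_zero,
      etaConfig_of_ne hjs, etaConfig_of_ne (mode_neg_ne_zero hjs), zero_sub]
  have hNN : (N : ℝ) + (0 : ℕ) + (0 : ℕ) ≤ N := by simp
  -- The pivot is negative at the left endpoint; slope at least one makes it nonnegative after
  -- moving right by the absolute value of that negative number.
  obtain ⟨v, ⟨hv, -⟩, hv0⟩ : ∃ v ∈ Set.Icc (x - e * s)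
      (x - e * s - pivot N (e ^ 2) (x - e * s) N 0 0), pivot N (e ^ 2) v N 0 0 = 0 := by
    have hneg := hp.pivot_neg hNe3
    refine intermediate_value_Icc (f := fun v => pivot N (e ^ 2) v N 0 0) (by linarith)
      ((hp.pivot_continuousOn hN0 N 0 0 hNN).mono Set.Icc_subset_Ici_self)
      ⟨hneg.le, ?_⟩
    have := hp.pivot_mono hN0 le_rfl
      (v' := x - e * s - pivot N (e ^ 2) (x - e * s) N 0 0) (by linarith) N 0 0 hNN
    linarith
  have hvlt : x - e * s < v := lt_of_le_of_ne hv fun hh => by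
    have := hp.pivot_neg hNe3
    rw [hh, hv0] at this
    exact lt_irrefl _ this
  have hgap := gap_pos hL hjs
  have hzs : -(φ * v) < -(φ * (x - e * s)) := neg_lt_neg (mul_lt_mul_of_pos_left hvlt hφ)
  have hdiv : ∀ y : ℝ, -(-(φ * y)) / φ = y := fun y => by field_simp
  refine ⟨fun z hz => (hb z hz).flowWellDefined hjs hφ, -(φ * v), ⟨hzs.le, ?_, ?_⟩,
    lt_min (by linarith) hzs, fun z hz => ?_⟩
  · rw [hf _ hzs.le, hdiv, hv0]
    simp
  · intro z hz hfz
    rw [hf z hz, Complex.ofReal_eq_zero, mul_eq_zero] at hfz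
    have h1 : pivot N (e ^ 2) (-z / φ) N 0 0 = 0 := hfz.resolve_left hφ.ne'
    have h2 : x - e * s ≤ -z / φ := by rw [le_div_iff₀ hφ]; linarith
    have h3 : -z / φ = v := by
      rcases le_total (-z / φ) v with hle | hle
      · have := hp.pivot_mono hN0 h2 hle N 0 0 hNN
        linarith
      · have := hp.pivot_mono hN0 hv hle N 0 0 hNN
        linarith
    rw [← h3]
    field_simp
  · have hz1 : z < -(φ * v) + gap d L / 2 := lt_of_lt_of_le hz (min_le_left _ _)
    have hz2 : z ≤ -(φ * (x - e * s)) := (lt_of_lt_of_le hz (min_le_right _ _)).le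
    have hlow : ∀ c : Config d N, pairNum js c.1 = 0 → c ≠ etaConfig d N →
        gap d L / 2 ≤ sectorPivot N L φ js z c.1 := by
      intro c hc0 hc
      have hg := gap_le_restEnergy (L := L) hc0 hc
      have hcN : c.1 0 ≤ N := le_of_config c 0
      -- At `v` the pivot of the full chain is zero, so that of the chain with `c.1 0` particles is
      -- nonnegative. The actual shift exceeds `v` by more than `Δ₀ / (2 φ)`, since the rest energy
      -- is at least `Δ₀` and `z < z⋆ + Δ₀ / 2`.
      have hanti := hp.pivot_antitone hNe hv hcN le_rfl
      have hvle : v ≤ (restEnergy L js c.1 - z) / φ := by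
        rw [le_div_iff₀ hφ]; linarith
      have hmono := hp.pivot_mono hN0 hv hvle (c.1 0) 0 0 (by
        have : (c.1 0 : ℝ) ≤ N := by exact_mod_cast hcN
        simpa using this)
      rw [pairNum, Nat.add_eq_zero_iff] at hc0
      rw [sectorPivot, he, hc0.1, hc0.2]
      have h1 : (restEnergy L js c.1 - z) / φ - v
          ≤ pivot N (e ^ 2) ((restEnergy L js c.1 - z) / φ) (c.1 0) 0 0 := by linarith
      have h2 := mul_le_mul_of_nonneg_left h1 hφ.le
      have h3 : φ * ((restEnergy L js c.1 - z) / φ - v) = restEnergy L js c.1 - z - φ * v := by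
        field_simp
      linarith
    obtain ⟨B, -, hB⟩ := (hb z hz2).isReducedInverse_PetaBar hjs hφ hN2 hev (half_pos hgap) hlow
    exact ⟨⟨B, hB⟩, (hb z hz2).KN_eq hjs hφ hN2 hev (half_pos hgap) hlow⟩
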